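/- Let $\mathcal H$ be an infinite-dimensional complex Hilbert space and let $A$ be a self-adjoint operator on $\mathcal H$, possibly unbounded, that is bounded from below (in particular $A$ may be bounded). Let $\mathfrak a$ be the closed quadratic form of $A$, let $m=\min\sigma(A)$, and let $\mathcal H_{\mathfrak a}=\mathrm{Dom}(\mathfrak a)$ carry the norm $\|u\|_{\mathfrak a}=(\mathfrak a[u,u]-(m-1)\|u\|^2)^{1/2}=\|(A-m+1)^{1/2}u\|$. For subspaces $\mathcal U,\mathcal V$ of $\mathcal H$ put $\delta(\mathcal U,\mathcal V)=\sup_{u\in\mathcal U,\|u\|=1}\mathrm{dist}(u,\mathcal V)$ (which is $0$ if $\mathcal U=\{0\}$) and $\hat\delta(\mathcal U,\mathcal V)=\max\{\delta(\mathcal U,\mathcal V),\delta(\mathcal V,\mathcal U)\}$; write $\hat\delta_{\mathfrak a}$ for the same quantity computed for subspaces of $\mathcal H_{\mathfrak a}$ in the norm $\|\cdot\|_{\mathfrak a}$. Let $a<b$ be real numbers in the resolvent set $\rho(A)$ and $\Delta=[a,b]$, with $\sigma_{\mathrm{ess}}(A)\cap\Delta=\varnothing$ and $\sigma(A)\cap\Delta=\{\lambda_1,\dots,\lambda_d\}\neq\varnothing$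 (eigenvalues repeated according to multiplicity). Let $\mathcal L(\Delta)$ be the $d$-dimensional space spanned by the corresponding eigenvectors and $E$ the orthogonal projection onto $\mathcal L(\Delta)$. Let $(\mathcal L_n)$ be a sequence of finite-dimensional subspaces of $\mathrm{Dom}(\mathfrak a)$ such that for every $u\in\mathrm{Dom}(\mathfrak a)$ there are $u_n\in\mathcal L_n$ with $\|u-u_n\|_{\mathfrak a}\to0$. For a finite-dimensional subspace $\mathcal W\subset\mathrm{Dom}(\mathfrak a)$ let $\sigma(A,\mathcal W)$ be the set of those $\mu\in\mathbb R$ for which there is a nonzero $u\in\mathcal W$ with $\mathfrak a[u,v]=\mu\langle u,v\rangle$ for all $v\in\mathcal W$. Let $\mathcal L_n(\Delta)$ be the span of all $u\in\mathcal L_n$ satisfying $\mathfrak a[u,v]=\mu\langle u,v\rangle$ for all $v\in\mathcal L_n$ with some $\mu\in\Delta$, and let $Q_n$ be the orthogonal projection of $\mathcal H$ onto $\mathcal L_n(\Delta)$. Let $\mathcal L$ be a fixed finite-dimensional subspace of $\mathcal H$ with orthogonal projection $P$, and suppose that $\delta(\mathcal L(\Delta),\mathcal L)<1$. Then $\gamma:=\min\sigma_{\mathrm{dis}}(EPE)$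 exists and $\gamma>0$. Let $\mathcal M_n$ be the spectral subspace of the self-adjoint operator $Q_nP|_{\mathcal L_n(\Delta)}$ on $\mathcal L_n(\Delta)$ associated with the interval $[\gamma/2,1]$. Then, as $n\to\infty$, $$\hat\delta(\mathcal M_n,\mathcal L(\Delta))\to0,\qquad \hat\delta_{\mathfrak a}(\mathcal M_n,\mathcal L(\Delta))\to0,\qquad d_H\big(\sigma(A,\mathcal M_n),\{\lambda_1,\dots,\lambda_d\}\big)\to0,$$ where $d_H$ is the Hausdorff distance. -/

import Mathlib

open Filter Topology
open scoped ComplexInnerProductSpace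

noncomputable section

namespace SpectralApprox

/-! ### Gap between subspaces -/

section Gap

variable {E : Type*} [AddCommGroup E] [Module ℂ E]

/-- The one-sided gap `δ(L, M) = sup {dist (u, M) : u ∈ L, ‖u‖ = 1}` between two subspaces of a
vector space carrying the norm `N`, where `dist (u, M) = inf {N (u - v) : v ∈ M}`.
It is `0` when `L` is the zero subspace. -/
def gap (N : E → ℝ) (L M : Submodule ℂ E) : ℝ :=
  sSup {r : ℝ | ∃ u ∈ L, N u = 1 ∧ r = ⨅ v : M, N (u - (v : E))}

/-- The symmetric gap `max {δ(L, M), δ(M, L)}`. -/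
def symGap (N : E → ℝ) (L M : Submodule ℂ E) : ℝ :=
  max (gap N L M) (gap N M L)

end Gap

variable {H : Type*} [NormedAddCommGroup H] [InnerProductSpace ℂ H]

/-! ### Spectra of (possibly unbounded) operators -/

/-- The bounded operator `R` is the inverse of `A - z : Dom A → H`. -/
def IsResolventAt (A : H →ₗ.[ℂ] H) (z : ℂ) (R : H →L[ℂ] H) : Prop :=
  (∀ u : A.domain, R (A u - z • (u : H)) = u) ∧
    ∀ x : H, ∃ u : A.domain, (u : H) = R x ∧ A u - z • (u : H) = x

/-- The resolvent set `ρ(A)`. -/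
def opResolventSet (A : H →ₗ.[ℂ] H) : Set ℂ := {z | ∃ R : H →L[ℂ] H, IsResolventAt A z R}

/-- The spectrum `σ(A)`. -/
def spec (A : H →ₗ.[ℂ] H) : Set ℂ := (opResolventSet A)ᶜ

/-- The eigenspace `{u ∈ Dom A : A u = z u}`, as a subspace of `H`. -/
def eigSpace (A : H →ₗ.[ℂ] H) (z : ℂ) : Submodule ℂ H :=
  (LinearMap.ker (A.toFun - z • A.domain.subtype)).map A.domain.subtype

/-- The discrete spectrum `σ_dis(A)` of a self-adjoint operator: the isolated points of the spectrum
which are eigenvalues of finite multiplicity. -/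
def discSpec (A : H →ₗ.[ℂ] H) : Set ℂ :=
  {z | z ∈ spec A ∧ (∃ ε > 0, ∀ w ∈ spec A, ‖w - z‖ < ε → w = z) ∧
    eigSpace A z ≠ ⊥ ∧ FiniteDimensional ℂ (eigSpace A z)}

/-- The essential spectrum `σ_ess(A) = σ(A) \ σ_dis(A)` of a self-adjoint operator. -/
def essSpec (A : H →ₗ.[ℂ] H) : Set ℂ := spec A \ discSpec A

/-- A bounded operator, regarded as an operator with domain the whole space. -/
def ofBounded (T : H →L[ℂ] H) : H →ₗ.[ℂ] H := (T : H →ₗ[ℂ] H).toPMap ⊤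

/-- `A` is semi-bounded from below. -/
def SemiboundedBelow (A : H →ₗ.[ℂ] H) : Prop :=
  ∃ c : ℝ, ∀ u : A.domain, c * ‖(u : H)‖ ^ 2 ≤ (⟪(u : H), A u⟫).re

/-- The space `L(Δ)` for `Δ = [a, b]`: the closed linear span of all eigenvectors of `A` with
eigenvalue in `Δ`. When `σ_ess(A)` does not meet `Δ`, it is the (finite-dimensional) spectral
subspace of the self-adjoint operator `A` for `Δ`. -/
def eigSpaceIcc (A : H →ₗ.[ℂ] H) (a b : ℝ) : Submodule ℂ H :=
  (⨆ t ∈ Set.Icc a b, eigSpace A (t : ℂ)).topologicalClosure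

/-! ### The quadratic form of a semi-bounded self-adjoint operator -/

/-- The bottom `m = min σ(A)` of the spectrum of a semi-bounded self-adjoint operator. -/
def specMin (A : H →ₗ.[ℂ] H) : ℝ := sInf {t : ℝ | (t : ℂ) ∈ spec A}

open Classical in
/-- The resolvent `(A - z)⁻¹` for `z ∈ ρ(A)` (and `0` for other `z`). -/
def opResolvent (A : H →ₗ.[ℂ] H) (z : ℂ) : H →L[ℂ] H :=
  if h : ∃ R : H →L[ℂ] H, IsResolventAt A z R then h.choose else 0

section Form

variable [CompleteSpace H]

/-- The positive self-adjoint operator `(A - m + 1)^{1/2}`, where `m = min σ(A)`, as the inverse of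
the injective bounded operator `((A - (m - 1))⁻¹)^{1/2}`. -/
def sqrtShift (A : H →ₗ.[ℂ] H) : H →ₗ.[ℂ] H :=
  (ofBounded (CFC.sqrt (opResolvent A ((specMin A - 1 : ℝ) : ℂ)))).inverse

/-- The form domain `Dom(𝔞) = Dom((A - m + 1)^{1/2})`. -/
def formDomain (A : H →ₗ.[ℂ] H) : Submodule ℂ H := (sqrtShift A).domain

/-- The closed quadratic form `𝔞[u, v]` of `A`, linear in `u` and conjugate linear in `v`, that is
`𝔞[u, v] = ⟨(A - m + 1)^{1/2} u, (A - m + 1)^{1/2} v⟩ + (m - 1) ⟨u, v⟩`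
for the inner product `⟨x, y⟩` that is linear in `x`, written `⟪y, x⟫` in Mathlib. -/
def form (A : H →ₗ.[ℂ] H) (u v : formDomain A) : ℂ :=
  ⟪sqrtShift A v, sqrtShift A u⟫ + ((specMin A - 1 : ℝ) : ℂ) * ⟪(v : H), (u : H)⟫

theorem form_add_left (A : H →ₗ.[ℂ] H) (u v w : formDomain A) :
    form A (u + v) w = form A u w + form A v w := by
  have h : sqrtShift A (u + v) = sqrtShift A u + sqrtShift A v := (sqrtShift A).map_add u v
  unfold form
  rw [h, Submodule.coe_add, inner_add_right, inner_add_right]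
  ring

theorem form_smul_left (A : H →ₗ.[ℂ] H) (c : ℂ) (u w : formDomain A) :
    form A (c • u) w = c * form A u w := by
  have h : sqrtShift A (c • u) = c • sqrtShift A u := (sqrtShift A).map_smul c u
  unfold form
  rw [h, Submodule.coe_smul, inner_smul_right, inner_smul_right]
  ring

/-- The norm `‖u‖_𝔞 = (𝔞[u, u] - (m - 1) ⟨u, u⟩)^{1/2}` on the form domain. -/
def formNorm (A : H →ₗ.[ℂ] H) (u : formDomain A) : ℝ :=
  Real.sqrt ((form A u u).re - (specMin A - 1) * ‖(u : H)‖ ^ 2)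

/-- The symmetric gap between two subspaces of the form domain with respect to `‖·‖_𝔞`. -/
def symGapForm (A : H →ₗ.[ℂ] H) (L M : Submodule ℂ H) : ℝ :=
  symGap (formNorm A) (L.submoduleOf (formDomain A)) (M.submoduleOf (formDomain A))

/-! ### The Galerkin method -/

/-- The solutions `u ∈ W` of `𝔞[u, v] = μ ⟨u, v⟩` for all `v ∈ W`. -/
def galerkinEigSpace (A : H →ₗ.[ℂ] H) (W : Submodule ℂ H) (μ : ℝ) : Submodule ℂ H where
  carrier := {u | u ∈ W ∧ ∃ hu : u ∈ formDomain A,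
    ∀ v : formDomain A, (v : H) ∈ W → form A ⟨u, hu⟩ v = (μ : ℂ) * ⟪(v : H), u⟫}
  zero_mem' := by
    refine ⟨W.zero_mem, (formDomain A).zero_mem, fun v _ => ?_⟩
    have h : form A 0 v = 0 := by simpa using form_smul_left A 0 0 v
    rw [inner_zero_right, mul_zero]
    exact h
  add_mem' := by
    rintro x y ⟨hx, hx', h1⟩ ⟨hy, hy', h2⟩
    refine ⟨W.add_mem hx hy, (formDomain A).add_mem hx' hy', fun v hv => ?_⟩
    have h := form_add_left A ⟨x, hx'⟩ ⟨y, hy'⟩ v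
    rw [h1 v hv, h2 v hv] at h
    rw [inner_add_right, mul_add]
    exact h
  smul_mem' := by
    rintro c x ⟨hx, hx', h1⟩
    refine ⟨W.smul_mem c hx, (formDomain A).smul_mem c hx', fun v hv => ?_⟩
    have h := form_smul_left A c ⟨x, hx'⟩ v
    rw [h1 v hv] at h
    rw [inner_smul_right, mul_left_comm]
    exact h

/-- The Galerkin eigenvalues `σ(A, W)` with respect to a trial space `W`. -/
def galerkinSpec (A : H →ₗ.[ℂ] H) (W : Submodule ℂ H) : Set ℝ :=
  {μ | galerkinEigSpace A W μ ≠ ⊥}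

/-- The space spanned by the Galerkin eigenvectors with respect to `W` whose Galerkin eigenvalues
lie in `[a, b]`; for the trial space `W = L_n` this is `L_n(Δ)`. -/
def galerkinSpace (A : H →ₗ.[ℂ] H) (W : Submodule ℂ H) (a b : ℝ) : Submodule ℂ H :=
  ⨆ μ ∈ Set.Icc a b, galerkinEigSpace A W μ

theorem galerkinSpace_le (A : H →ₗ.[ℂ] H) (W : Submodule ℂ H) (a b : ℝ) :
    galerkinSpace A W a b ≤ W :=
  iSup₂_le fun _ _ _ hu => hu.1

instance instFiniteDimensionalGalerkinSpace (A : H →ₗ.[ℂ] H) (W : Submodule ℂ H)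
    [FiniteDimensional ℂ W] (a b : ℝ) : FiniteDimensional ℂ (galerkinSpace A W a b) :=
  Submodule.finiteDimensional_of_le (galerkinSpace_le A W a b)

/-! ### The auxiliary spectral problem -/

instance instCompleteSpaceEigSpaceIcc (A : H →ₗ.[ℂ] H) (a b : ℝ) :
    CompleteSpace (eigSpaceIcc A a b) :=
  (Submodule.isClosed_topologicalClosure _).completeSpace_coe

/-- The operator `E P E` on `H`, where `E` is the orthogonal projection onto `L(Δ)` and `P` the
orthogonal projection onto `L`. -/
def auxOp (A : H →ₗ.[ℂ] H) (a b : ℝ) (L : Submodule ℂ H) [FiniteDimensional ℂ L] : H →L[ℂ] H :=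
  (eigSpaceIcc A a b).starProjection ∘L L.starProjection ∘L (eigSpaceIcc A a b).starProjection

/-- For the orthogonal projections `Q`, `P` onto `V`, `L`: the compression `Q P|_V : V → V`. -/
def compression (V L : Submodule ℂ H) [FiniteDimensional ℂ V] [FiniteDimensional ℂ L] :
    V →ₗ[ℂ] V :=
  V.orthogonalProjectionOnto.toLinearMap ∘ₗ L.starProjection.toLinearMap ∘ₗ V.subtype

/-- The spectral subspace, regarded in `H`, of the compression `Q P|_V` for the interval
`[s, t]`, i.e. the span of its eigenvectors with eigenvalue in `[s, t]`. -/
def filteredSpace (V L : Submodule ℂ H) [FiniteDimensional ℂ V] [FiniteDimensional ℂ L]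
    (s t : ℝ) : Submodule ℂ H :=
  (⨆ μ ∈ Set.Icc s t, Module.End.eigenspace (compression V L) (μ : ℂ)).map V.subtype

end Form

end SpectralApprox

end

open SpectralApprox

/-!
The statement is reduced to bounded operators. Let `m = min σ(A)`, `κ = m - 1`, `R = (A - κ)⁻¹` and
`T = R^{1/2}`. Then `T` is an isometry of `H` onto the form domain with the norm `‖·‖_𝔞`, and for
`W = T X` the Galerkin eigenvectors in `W` with eigenvalue `μ` are the eigenvectors of
`S = T P_X T` with eigenvalue `(μ - κ)⁻¹`. Density of the trial spaces `L_n = T X_n` in the form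
norm says that `P_{X_n} → 1` strongly, hence `S_n = T P_{X_n} T → T T = R` strongly
(`FormRoot`, `FormRoot.galerkinSpace_eq`, `FormRoot.iSup_eigSpace_eq`).

Strong convergence allows spurious eigenvalues of `S_n`, but the spectral projections `Q_n` of `S_n`
for an interval whose ends are not in the spectrum of `R` still converge strongly to the spectral
projection `E` of `R` (`tendsto_specProj_apply`). As `P` has finite rank, `Q_n P Q_n → E P E` in
norm (`tendsto_norm_compressionOp_sub`), and this removes the spurious part: the spectrum of `E P E` is
contained in `{0} ∪ [γ, 1]`, and its spectral projection for `[γ / 2, 1]` is `E`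
(`specProj_compressionOp_eq`). Norm perturbation theory compares this with the projection onto
`M_n` (`norm_sub_starProjection_le`, `norm_sub_specProj_le`).

To pass to the form norm, the projections are lifted through `T`: `Q_n = T Z_n` and `E = T Z` with
bounded `Z_n`, and `Z_n E → Z` in norm since `E` has finite rank (`eventually_relClose`). The
eigenvalues are compared through the Galerkin resolvents: if `X` and `Y` are close, so are
`T P_X T` and `T P_Y T` (`norm_ritzOp_sub_le`, `FormRoot.exists_mem_galerkinSpec`), and the Galerkin
eigenvalues for the spectral subspace itself are the eigenvalues of `A` in `[a, b]`
(`FormRoot.galerkinSpec_eigSpaceIcc`).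

Spectral projections are obtained from the continuous functional calculus: the indicator function
of a set is continuous on the spectrum when the set splits the spectrum into relatively open parts.
-/

noncomputable section

namespace SpectralApprox

/-! ### Spectral projections of bounded self-adjoint operators -/

section SpectralProjection

variable {H : Type*} [NormedAddCommGroup H] [InnerProductSpace ℂ H]

/-- The set `J` splits the spectrum of `B` into two relatively open parts. Nothing is required of
`J` away from the spectrum. -/
def SplitsSpectrum (B : H →L[ℂ] H) (J : Set ℝ) : Prop :=
  ∀ x ∈ spectrum ℝ B, ∀ᶠ y in 𝓝[spectrum ℝ B] x, (y ∈ J ↔ x ∈ J)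

/-- The span of all eigenvectors of `B` with eigenvalue in `J`. -/
def eigSum (B : H →L[ℂ] H) (J : Set ℝ) : Submodule ℂ H :=
  ⨆ t ∈ J, Module.End.eigenspace (B : H →ₗ[ℂ] H) (t : ℂ)

variable {B : H →L[ℂ] H} {J : Set ℝ}

theorem mem_eigenspace_iff {t : ℂ} {x : H} :
    x ∈ Module.End.eigenspace (B : H →ₗ[ℂ] H) t ↔ B x = t • x := by
  rw [Module.End.mem_eigenspace_iff]; rfl

theorem mem_eigSum {t : ℝ} {x : H} (ht : t ∈ J) (hx : B x = (t : ℂ) • x) : x ∈ eigSum B J :=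
  Submodule.mem_iSup_of_mem t (Submodule.mem_iSup_of_mem ht (mem_eigenspace_iff.2 hx))

theorem SplitsSpectrum.compl (h : SplitsSpectrum B J) : SplitsSpectrum B Jᶜ := by
  intro x hx
  filter_upwards [h x hx] with y hy
  simp [hy]

theorem splitsSpectrum_of_isolated (hfin : (spectrum ℝ B ∩ J).Finite)
    (hiso : ∀ t ∈ spectrum ℝ B ∩ J, ∃ ε > 0, ∀ s ∈ spectrum ℝ B, |s - t| < ε → s = t) :
    SplitsSpectrum B J := by
  intro x hx
  by_cases hxJ : x ∈ J
  · obtain ⟨ε, hε, h⟩ := hiso x ⟨hx, hxJ⟩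
    filter_upwards [self_mem_nhdsWithin, mem_nhdsWithin_of_mem_nhds (Metric.ball_mem_nhds x hε)]
      with y hy hy'
    rw [h y hy (by simpa [Real.dist_eq] using hy')]
  · have : (spectrum ℝ B ∩ J)ᶜ ∈ 𝓝 x := hfin.isClosed.isOpen_compl.mem_nhds fun h => hxJ h.2
    filter_upwards [self_mem_nhdsWithin, mem_nhdsWithin_of_mem_nhds this] with y hy hy'
    simp only [hxJ, iff_false]
    exact fun h => hy' ⟨hy, h⟩

theorem splitsSpectrum_of_finite (hfin : (spectrum ℝ B).Finite) (J : Set ℝ) :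
    SplitsSpectrum B J := by
  refine splitsSpectrum_of_isolated (hfin.inter_of_left J) fun t ht => ?_
  have h1 : (spectrum ℝ B \ {t})ᶜ ∈ 𝓝 t :=
    (hfin.subset Set.sdiff_subset).isClosed.isOpen_compl.mem_nhds fun h => h.2 rfl
  obtain ⟨ε, hε, h⟩ := Metric.mem_nhds_iff.1 h1
  refine ⟨ε, hε, fun s hs hst => ?_⟩
  by_contra hne
  exact h (show s ∈ Metric.ball t ε by simpa [Real.dist_eq] using hst) ⟨hs, hne⟩

theorem SplitsSpectrum.continuousOn_indicator (h : SplitsSpectrum B J) {g : ℝ → ℝ}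
    (hg : ContinuousOn g (spectrum ℝ B ∩ J)) : ContinuousOn (J.indicator g) (spectrum ℝ B) := by
  intro x hx
  by_cases hxJ : x ∈ J
  · have h1 : J ∈ 𝓝[spectrum ℝ B] x := by
      filter_upwards [h x hx] with y hy using hy.2 hxJ
    have h2 : ContinuousWithinAt g (spectrum ℝ B) x := by
      have := hg x ⟨hx, hxJ⟩
      rwa [continuousWithinAt_inter' h1] at this
    refine h2.congr_of_eventuallyEq ?_ (by simp [hxJ])
    filter_upwards [h1] with y hy using by simp [hy]
  · refine (continuousWithinAt_const (b := (0 : ℝ))).congr_of_eventuallyEq ?_ (by simp [hxJ])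
    filter_upwards [h x hx] with y hy
    have : y ∉ J := fun hh => hxJ (hy.1 hh)
    simp [this]

/-- An operator with range in a finite-dimensional space is annihilated by a polynomial, so its
spectrum is finite. -/
theorem finite_spectrum_of_range_le (W : Submodule ℂ H) [FiniteDimensional ℂ W]
    (hW : ∀ x, B x ∈ W) : (spectrum ℝ B).Finite := by
  suffices hC : (spectrum ℂ B).Finite by
    have : spectrum ℝ B = (fun t : ℝ => (t : ℂ)) ⁻¹' spectrum ℂ B := by
      ext t
      exact (spectrum.algebraMap_mem_iff ℂ).symm
    rw [this]
    exact hC.preimage Complex.ofReal_injective.injOn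
  -- with `C` the restriction of `B` to `W`, the polynomial `charpoly C * X` annihilates `B`
  let C : Module.End ℂ W := (B : H →ₗ[ℂ] H).restrict fun x _ => hW x
  have hCp : ∀ (p : Polynomial ℂ) (x : W),
      ((Polynomial.aeval C p x : W) : H) = Polynomial.aeval B p (x : H) := by
    intro p x
    induction p using Polynomial.induction_on' with
    | add p q hp hq => simp [hp, hq]
    | monomial n a =>
      have : ∀ n : ℕ, ((C ^ n) x : H) = (B ^ n) (x : H) := by
        intro n
        induction n with
        | zero => simp
        | succ n ih =>
          rw [pow_succ', pow_succ', Module.End.mul_apply, mul_apply_eq_comp, ← ih]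
          rfl
      simp [Polynomial.aeval_monomial, this, Algebra.algebraMap_eq_smul_one]
  set q : Polynomial ℂ := C.charpoly * Polynomial.X with hq
  have hq0 : q ≠ 0 := mul_ne_zero (LinearMap.charpoly_monic C).ne_zero Polynomial.X_ne_zero
  have hqB : Polynomial.aeval B q = 0 := by
    ext x
    rw [hq, map_mul, Polynomial.aeval_X, mul_apply_eq_comp]
    have := hCp C.charpoly ⟨B x, hW x⟩
    rw [LinearMap.aeval_self_charpoly] at this
    simpa using this.symm
  refine (q.roots.toFinset.finite_toSet).subset fun z hz => ?_
  have h1 := spectrum.subset_polynomial_aeval B q ⟨z, hz, rfl⟩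
  rw [hqB] at h1
  have : Nontrivial (H →L[ℂ] H) := by
    by_contra hn
    rw [not_nontrivial_iff_subsingleton] at hn
    exact hz (isUnit_of_subsingleton _)
  rw [spectrum.zero_eq] at h1
  simp [hq0, Polynomial.IsRoot] at h1 ⊢
  exact h1

theorem continuousOn_inv_sub {c δ : ℝ} (hδ : 0 < δ) (hJ : ∀ x ∈ spectrum ℝ B ∩ J, δ ≤ |x - c|) :
    ContinuousOn (fun x => (x - c)⁻¹) (spectrum ℝ B ∩ J) := by
  refine ContinuousOn.inv₀ (by fun_prop) fun x hx h0 => ?_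
  have := hJ x hx
  rw [h0, abs_zero] at this
  linarith

theorem mem_spectrum_of_apply_eq {t : ℝ} {x : H} (hx0 : x ≠ 0) (hx : B x = (t : ℂ) • x) :
    t ∈ spectrum ℝ B := by
  by_contra hnot
  rw [spectrum.notMem_iff, Algebra.algebraMap_eq_smul_one] at hnot
  obtain ⟨U, hU⟩ := hnot
  have h1 : (U : H →L[ℂ] H) x = 0 := by
    rw [hU, sub_apply, hx, smul_apply, one_apply_eq_self, sub_eq_zero]
    rfl
  have h2 := congrArg (fun T : H →L[ℂ] H => T x) U.inv_mul
  simp only [mul_apply_eq_comp, h1, map_zero, one_apply_eq_self] at h2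
  exact hx0 h2.symm

variable [CompleteSpace H]

/-- The operator `(𝟙_J g)(B)` of the continuous functional calculus. It is meaningful when `J`
splits the spectrum of `B` and `g` is continuous on the part of the spectrum in `J`. -/
def cutoff (B : H →L[ℂ] H) (J : Set ℝ) (g : ℝ → ℝ) : H →L[ℂ] H := cfc (J.indicator g) B

/-- The spectral projection `𝟙_J(B)`, for a set `J` that splits the spectrum of `B`. -/
def specProj (B : H →L[ℂ] H) (J : Set ℝ) : H →L[ℂ] H := cutoff B J 1

theorem cutoff_mul (h : SplitsSpectrum B J) {f g : ℝ → ℝ}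
    (hf : ContinuousOn f (spectrum ℝ B ∩ J)) (hg : ContinuousOn g (spectrum ℝ B ∩ J)) :
    cutoff B J f * cutoff B J g = cutoff B J (f * g) := by
  unfold cutoff
  rw [← cfc_mul _ _ _ (h.continuousOn_indicator hf) (h.continuousOn_indicator hg)]
  congr 1
  ext x
  by_cases hx : x ∈ J <;> simp [hx]

theorem cutoff_congr {f g : ℝ → ℝ} (hfg : ∀ x ∈ spectrum ℝ B ∩ J, f x = g x) :
    cutoff B J f = cutoff B J g := by
  refine cfc_congr fun x hx => ?_
  by_cases hxJ : x ∈ J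
  · simpa [hxJ] using hfg x ⟨hx, hxJ⟩
  · simp [hxJ]

theorem norm_cutoff_le {g : ℝ → ℝ} {c : ℝ} (hc : 0 ≤ c)
    (hg : ∀ x ∈ spectrum ℝ B ∩ J, |g x| ≤ c) : ‖cutoff B J g‖ ≤ c := by
  refine norm_cfc_le hc fun x hx => ?_
  by_cases hxJ : x ∈ J
  · simpa [hxJ] using hg x ⟨hx, hxJ⟩
  · simpa [hxJ] using hc

theorem isSelfAdjoint_cutoff (g : ℝ → ℝ) : IsSelfAdjoint (cutoff B J g) :=
  cfc_predicate _ B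

theorem isStarProjection_specProj (h : SplitsSpectrum B J) :
    IsStarProjection (specProj B J) := by
  refine ⟨?_, isSelfAdjoint_cutoff _⟩
  show cutoff B J 1 * cutoff B J 1 = cutoff B J 1
  rw [cutoff_mul h continuous_one.continuousOn continuous_one.continuousOn, mul_one]

theorem specProj_specProj (h : SplitsSpectrum B J) (x : H) :
    specProj B J (specProj B J x) = specProj B J x :=
  congrArg (fun T : H →L[ℂ] H => T x) (isStarProjection_specProj h).isIdempotentElem

theorem cutoff_mul_specProj (h : SplitsSpectrum B J) {g : ℝ → ℝ}
    (hg : ContinuousOn g (spectrum ℝ B ∩ J)) : cutoff B J g * specProj B J = cutoff B J g := by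
  rw [specProj, cutoff_mul h hg continuous_one.continuousOn, mul_one]

theorem specProj_mul_cutoff (h : SplitsSpectrum B J) {g : ℝ → ℝ}
    (hg : ContinuousOn g (spectrum ℝ B ∩ J)) : specProj B J * cutoff B J g = cutoff B J g := by
  rw [specProj, cutoff_mul h continuous_one.continuousOn hg, one_mul]

theorem sub_smul_eq_cfc (hB : IsSelfAdjoint B) (c : ℝ) :
    B - (c : ℂ) • 1 = cfc (fun x : ℝ => x - c) B := by
  rw [cfc_sub (fun x : ℝ => x) (fun _ => c) B continuousOn_id continuousOn_const, cfc_id' ℝ B,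
    cfc_const c B, Algebra.algebraMap_eq_smul_one]
  congr 1

theorem sub_smul_mul_cutoff (hB : IsSelfAdjoint B) (h : SplitsSpectrum B J) (c : ℝ) {g : ℝ → ℝ}
    (hg : ContinuousOn g (spectrum ℝ B ∩ J)) :
    (B - (c : ℂ) • 1) * cutoff B J g = cutoff B J (fun x => (x - c) * g x) := by
  rw [sub_smul_eq_cfc hB, cutoff,
    ← cfc_mul _ _ _ (by fun_prop) (h.continuousOn_indicator hg), cutoff]
  congr 1
  ext x
  by_cases hx : x ∈ J <;> simp [hx]

theorem cutoff_mul_sub_smul (hB : IsSelfAdjoint B) (h : SplitsSpectrum B J) (c : ℝ) {g : ℝ → ℝ}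
    (hg : ContinuousOn g (spectrum ℝ B ∩ J)) :
    cutoff B J g * (B - (c : ℂ) • 1) = cutoff B J (fun x => (x - c) * g x) := by
  rw [← sub_smul_mul_cutoff hB h c hg, sub_smul_eq_cfc hB]
  exact cfc_commute_cfc _ _ _

theorem specProj_compl (hB : IsSelfAdjoint B) (h : SplitsSpectrum B J) :
    specProj B Jᶜ = 1 - specProj B J := by
  unfold specProj cutoff
  rw [eq_sub_iff_add_eq, ← cfc_add (a := B) _ _
    (h.compl.continuousOn_indicator continuous_one.continuousOn)
    (h.continuousOn_indicator continuous_one.continuousOn), ← cfc_one ℝ B]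
  congr 1
  ext x
  by_cases hx : x ∈ J <;> simp [hx]

/-- On the range of `𝟙_J(B)`, the operator `B - c` is bounded by `r` if the part of the spectrum
in `J` is within distance `r` of `c`. -/
theorem norm_sub_smul_le (hB : IsSelfAdjoint B) (h : SplitsSpectrum B J) {c r : ℝ} (hr : 0 ≤ r)
    (hJ : ∀ x ∈ spectrum ℝ B ∩ J, |x - c| ≤ r) {x : H} (hx : specProj B J x = x) :
    ‖B x - (c : ℂ) • x‖ ≤ r * ‖x‖ := by
  have h1 : B x - (c : ℂ) • x = cutoff B J (fun x => (x - c) * 1) x := by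
    have := sub_smul_mul_cutoff hB h c (g := 1) continuousOn_const
    have h2 := congrArg (fun T : H →L[ℂ] H => T x) this
    simp only [mul_apply_eq_comp] at h2
    rw [show cutoff B J 1 x = x from hx] at h2
    simpa using h2
  rw [h1]
  refine (ContinuousLinearMap.le_opNorm _ _).trans ?_
  gcongr
  exact norm_cutoff_le hr fun x hx => by simpa using hJ x hx

theorem specProj_apply_sub_smul (hB : IsSelfAdjoint B) (h : SplitsSpectrum B J) (c : ℝ) (x : H) :
    specProj B J (B x - (c : ℂ) • x) = B (specProj B J x) - (c : ℂ) • specProj B J x :=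
  congrArg (fun T : H →L[ℂ] H => T x)
    ((cutoff_mul_sub_smul hB h c (g := 1) continuous_one.continuousOn).trans
      (sub_smul_mul_cutoff hB h c (g := 1) continuous_one.continuousOn).symm)

/-- The inverse of `B - c` on the range of `𝟙_J(B)`, extended by `0`. -/
def partialInverse (B : H →L[ℂ] H) (J : Set ℝ) (c : ℝ) : H →L[ℂ] H :=
  cutoff B J fun x => (x - c)⁻¹

section partialInverse

variable {c δ : ℝ} (hδ : 0 < δ) (hJ : ∀ x ∈ spectrum ℝ B ∩ J, δ ≤ |x - c|)

include hδ hJ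

theorem norm_partialInverse_le : ‖partialInverse B J c‖ ≤ δ⁻¹ := by
  refine norm_cutoff_le (by positivity) fun x hx => ?_
  rw [abs_inv]
  exact inv_anti₀ hδ (hJ x hx)

theorem sub_smul_mul_partialInverse (hB : IsSelfAdjoint B) (h : SplitsSpectrum B J) :
    (B - (c : ℂ) • 1) * partialInverse B J c = specProj B J := by
  rw [partialInverse, sub_smul_mul_cutoff hB h c (continuousOn_inv_sub hδ hJ), specProj]
  refine cutoff_congr fun x hx => mul_inv_cancel₀ fun h0 => ?_
  have := hJ x hx
  rw [h0, abs_zero] at this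
  linarith

theorem partialInverse_mul_sub_smul (hB : IsSelfAdjoint B) (h : SplitsSpectrum B J) :
    partialInverse B J c * (B - (c : ℂ) • 1) = specProj B J := by
  rw [← sub_smul_mul_partialInverse hδ hJ hB h, partialInverse,
    cutoff_mul_sub_smul hB h c (continuousOn_inv_sub hδ hJ),
    sub_smul_mul_cutoff hB h c (continuousOn_inv_sub hδ hJ)]

theorem specProj_mul_partialInverse (h : SplitsSpectrum B J) :
    specProj B J * partialInverse B J c = partialInverse B J c :=
  specProj_mul_cutoff h (continuousOn_inv_sub hδ hJ)

theorem partialInverse_mul_specProj (h : SplitsSpectrum B J) :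
    partialInverse B J c * specProj B J = partialInverse B J c :=
  cutoff_mul_specProj h (continuousOn_inv_sub hδ hJ)

/-- On the range of `𝟙_J(B)`, the operator `B - c` is bounded below by the distance of `c` to the
part of the spectrum in `J`. -/
theorem le_norm_sub_smul (hB : IsSelfAdjoint B) (h : SplitsSpectrum B J) (x : H) :
    δ * ‖specProj B J x‖ ≤ ‖B x - (c : ℂ) • x‖ := by
  have h1 : specProj B J x = partialInverse B J c (B x - (c : ℂ) • x) := by
    rw [← partialInverse_mul_sub_smul hδ hJ hB h]
    simp
  have h2 := (partialInverse B J c).le_opNorm (B x - (c : ℂ) • x)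
  rw [← h1] at h2
  have h3 := h2.trans (mul_le_mul_of_nonneg_right (norm_partialInverse_le hδ hJ) (norm_nonneg _))
  rw [inv_mul_eq_div, le_div_iff₀ hδ] at h3
  linarith

end partialInverse

/-- If the part of the spectrum of `B` in `J` consists of finitely many isolated points, then it
consists of eigenvalues and `𝟙_J(B)` projects onto the span of the eigenspaces. -/
theorem range_specProj (hB : IsSelfAdjoint B) (h : SplitsSpectrum B J)
    (hfin : (spectrum ℝ B ∩ J).Finite) : (specProj B J).range = eigSum B J := by
  have hsing : ∀ t ∈ spectrum ℝ B ∩ J, SplitsSpectrum B {t} := by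
    intro t ht x hx
    by_cases hxt : x = t
    · subst hxt
      have h0 : ((spectrum ℝ B ∩ J) \ {x})ᶜ ∈ 𝓝 x :=
        (hfin.subset Set.sdiff_subset).isClosed.isOpen_compl.mem_nhds fun h => h.2 rfl
      filter_upwards [h x hx, self_mem_nhdsWithin, mem_nhdsWithin_of_mem_nhds h0] with y h1 h2 h3
      simp only [Set.mem_singleton_iff, iff_true]
      by_contra hne
      exact h3 ⟨⟨h2, h1.2 ht.2⟩, hne⟩
    · filter_upwards [mem_nhdsWithin_of_mem_nhds (isOpen_ne.mem_nhds hxt)] with y hy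
      simp only [Set.mem_singleton_iff, hxt, iff_false]
      exact hy
  refine le_antisymm ?_ ?_
  · -- `𝟙_J(B)` is the sum of the spectral projections of the single points.
    have hsum : specProj B J = ∑ t ∈ hfin.toFinset, specProj B {t} := by
      unfold specProj cutoff
      rw [← cfc_sum (hf := fun t ht => (hsing t (hfin.mem_toFinset.1 ht)).continuousOn_indicator
        continuous_one.continuousOn)]
      refine cfc_congr fun x hx => ?_
      rw [Finset.sum_apply]
      by_cases hxJ : x ∈ J
      · rw [Finset.sum_eq_single x]
        · simp [hxJ]
        · intro b _ hb
          simp [Ne.symm hb]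
        · intro hn
          exact absurd (hfin.mem_toFinset.2 ⟨hx, hxJ⟩) hn
      · rw [Set.indicator_of_notMem hxJ, Finset.sum_eq_zero]
        intro t ht
        refine Set.indicator_of_notMem (fun hxt => hxJ ?_) _
        rw [Set.mem_singleton_iff.1 hxt]
        exact (hfin.mem_toFinset.1 ht).2
    rintro _ ⟨x, rfl⟩
    rw [hsum]
    simp only [ContinuousLinearMap.coe_coe, sum_apply]
    refine Submodule.sum_mem _ fun t ht => ?_
    have ht' := hfin.mem_toFinset.1 ht
    refine mem_eigSum ht'.2 ?_
    have h1 : (B - (t : ℂ) • 1) * specProj B {t} = 0 := by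
      rw [specProj, sub_smul_mul_cutoff hB (hsing t ht') t continuous_one.continuousOn,
        cutoff_congr (g := 0)]
      · unfold cutoff
        rw [show Set.indicator {t} (0 : ℝ → ℝ) = 0 by simp]
        exact cfc_zero ℝ B
      · rintro x ⟨-, hx⟩
        rw [Set.mem_singleton_iff.1 hx]
        simp
    have h2 := congrArg (fun T : H →L[ℂ] H => T x) h1
    simpa [sub_eq_zero] using h2
  · refine iSup₂_le fun t ht x hx => ?_
    rw [mem_eigenspace_iff] at hx
    -- `1 - 𝟙_J` is a continuous multiple of the function `s ↦ s - t` on the spectrum.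
    have hc : ContinuousOn (fun s => (s - t)⁻¹) (spectrum ℝ B ∩ Jᶜ) :=
      ContinuousOn.inv₀ (by fun_prop) fun s hs h0 => hs.2 (by rwa [sub_eq_zero.1 h0])
    have h1 : cutoff B Jᶜ (fun s => (s - t)⁻¹) * (B - (t : ℂ) • 1) = specProj B Jᶜ := by
      rw [cutoff_mul_sub_smul hB h.compl t hc, specProj]
      exact cutoff_congr fun s hs => mul_inv_cancel₀ fun h0 => hs.2 (by rwa [sub_eq_zero.1 h0])
    have h2 := congrArg (fun T : H →L[ℂ] H => T x) h1
    simp only [mul_apply_eq_comp, sub_apply,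
      smul_apply, one_apply_eq_self, hx, sub_self, map_zero,
      specProj_compl hB h] at h2
    exact ⟨x, (sub_eq_zero.1 h2.symm).symm⟩

theorem specProj_apply_of_mem (hB : IsSelfAdjoint B) (h : SplitsSpectrum B J)
    (hfin : (spectrum ℝ B ∩ J).Finite) {x : H} (hx : x ∈ eigSum B J) : specProj B J x = x := by
  rw [← range_specProj hB h hfin] at hx
  obtain ⟨y, rfl⟩ := hx
  exact specProj_specProj h y

theorem specProj_apply_mem (hB : IsSelfAdjoint B) (h : SplitsSpectrum B J)
    (hfin : (spectrum ℝ B ∩ J).Finite) (x : H) : specProj B J x ∈ eigSum B J := by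
  rw [← range_specProj hB h hfin]
  exact ⟨x, rfl⟩

theorem starProjection_eq_specProj (hB : IsSelfAdjoint B) (h : SplitsSpectrum B J)
    (hfin : (spectrum ℝ B ∩ J).Finite) (V : Submodule ℂ H) [V.HasOrthogonalProjection]
    (hV : V = eigSum B J) : V.starProjection = specProj B J := by
  obtain ⟨_, h1⟩ := isStarProjection_iff_eq_starProjection_range.1 (isStarProjection_specProj h)
  rw [h1]
  congr 1
  rw [hV, range_specProj hB h hfin]

end SpectralProjection

/-! ### Reduction to bounded operators -/

section Unbounded

variable {H : Type*} [NormedAddCommGroup H] [InnerProductSpace ℂ H]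

/-- The resolvent set of `A` in terms of the spectrum of one resolvent. -/
theorem IsResolventAt.mem_opResolventSet_iff {A : H →ₗ.[ℂ] H} {κ : ℂ} {R : H →L[ℂ] H}
    (hR : IsResolventAt A κ R) {z : ℂ} (hz : z ≠ κ) :
    z ∈ opResolventSet A ↔ (z - κ)⁻¹ ∉ spectrum ℂ R := by
  set w := z - κ with hw
  have hw0 : w ≠ 0 := sub_ne_zero.2 hz
  have hzw : z = κ + w := by rw [hw]; ring
  rw [spectrum.notMem_iff, Algebra.algebraMap_eq_smul_one]
  constructor
  · rintro ⟨Rz, h1, h2⟩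
    -- the two forms of the resolvent identity
    have e1 : ∀ x, Rz x = R x + w • R (Rz x) := by
      intro x
      obtain ⟨u, hu, hx⟩ := h2 x
      have := hR.1 u
      rw [← hu, ← map_smul, ← map_add]
      rw [show A u - κ • (u : H) = x + w • (u : H) by rw [← hx, hzw]; module] at this
      exact this.symm
    have e2 : ∀ x, R x = Rz x - w • Rz (R x) := by
      intro x
      obtain ⟨v, hv, hx⟩ := hR.2 x
      have := h1 v
      rw [← hv, ← map_smul, ← map_sub]
      rw [show A v - z • (v : H) = x - w • (v : H) by rw [← hx, hzw]; module] at this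
      exact this.symm
    refine ⟨⟨w⁻¹ • (1 : H →L[ℂ] H) - R, w • (1 + w • Rz), ?_, ?_⟩, rfl⟩
    · ext x
      show w⁻¹ • (w • (x + w • Rz x)) - R (w • (x + w • Rz x)) = x
      rw [inv_smul_smul₀ hw0, map_smul, map_add, map_smul, ← e1]
      module
    · ext x
      show w • ((w⁻¹ • x - R x) + w • Rz (w⁻¹ • x - R x)) = x
      rw [map_sub, map_smul, smul_sub w (w⁻¹ • Rz x), smul_inv_smul₀ hw0, ← e2, sub_add_cancel,
        smul_inv_smul₀ hw0]
  · rintro ⟨⟨D, Y, hDY, hYD⟩, rfl : D = _⟩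
    have e1 : ∀ x, w⁻¹ • Y x - R (Y x) = x := fun x => by
      simpa using congrArg (fun T : H →L[ℂ] H => T x) hDY
    have e2 : ∀ x, Y (w⁻¹ • x - R x) = x := fun x => by
      simpa using congrArg (fun T : H →L[ℂ] H => T x) hYD
    refine ⟨w⁻¹ • (R ∘L Y), fun u => ?_, fun x => ?_⟩
    · have hu := hR.1 u
      have h1 : A u - z • (u : H) =
          w • (w⁻¹ • (A u - κ • (u : H)) - R (A u - κ • (u : H))) := by
        rw [hu, smul_sub, smul_smul, mul_inv_cancel₀ hw0, hzw]
        module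
      simp only [smul_apply, ContinuousLinearMap.comp_apply]
      rw [h1, map_smul, e2, map_smul, smul_smul, inv_mul_cancel₀ hw0, one_smul, hu]
    · obtain ⟨u, hu, hx⟩ := hR.2 (w⁻¹ • Y x)
      refine ⟨u, by rw [hu, map_smul]; rfl, ?_⟩
      have : A u - z • (u : H) = (A u - κ • (u : H)) - w • (u : H) := by rw [hzw]; module
      rw [this, hx, hu, map_smul, smul_smul, mul_inv_cancel₀ hw0, one_smul, e1]

theorem IsResolventAt.apply_eq_zero {A : H →ₗ.[ℂ] H} {κ : ℂ} {R : H →L[ℂ] H}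
    (hR : IsResolventAt A κ R) {x : H} (hx : R x = 0) : x = 0 := by
  obtain ⟨u, hu, h⟩ := hR.2 x
  have hu0 : u = 0 := Subtype.ext (by rw [hu, hx]; rfl)
  rw [← h, hu0]
  simp

theorem mem_eigSpace {A : H →ₗ.[ℂ] H} {z : ℂ} {x : H} :
    x ∈ eigSpace A z ↔ ∃ u : A.domain, (u : H) = x ∧ A u = z • x := by
  simp only [eigSpace, Submodule.mem_map, LinearMap.mem_ker, LinearMap.sub_apply,
    LinearMap.smul_apply, sub_eq_zero, Submodule.subtype_apply]
  constructor
  · rintro ⟨u, h, rfl⟩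
    exact ⟨u, rfl, h⟩
  · rintro ⟨u, rfl, h⟩
    exact ⟨u, h, rfl⟩

/-- The eigenspaces of `A` are eigenspaces of a resolvent. -/
theorem IsResolventAt.eigSpace_eq {A : H →ₗ.[ℂ] H} {κ : ℂ} {R : H →L[ℂ] H}
    (hR : IsResolventAt A κ R) {z : ℂ} (hz : z ≠ κ) :
    eigSpace A z = Module.End.eigenspace (R : H →ₗ[ℂ] H) (z - κ)⁻¹ := by
  have hw0 : z - κ ≠ 0 := sub_ne_zero.2 hz
  ext x
  rw [mem_eigSpace, mem_eigenspace_iff]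
  constructor
  · rintro ⟨u, rfl, hu⟩
    have := hR.1 u
    rw [hu, ← sub_smul, map_smul] at this
    rw [eq_inv_smul_iff₀ hw0, this]
  · intro hx
    obtain ⟨u, hu, h⟩ := hR.2 x
    have hux : (u : H) = (z - κ)⁻¹ • x := by rw [hu, hx]
    refine ⟨(z - κ) • u, by simp [hux, smul_smul, mul_inv_cancel₀ hw0], ?_⟩
    rw [A.map_smul, ← sub_add_cancel (A u) (κ • (u : H)), h, hux, smul_add, smul_comm κ,
      smul_inv_smul₀ hw0]
    module

theorem eigSpace_eq_bot {A : H →ₗ.[ℂ] H} {z : ℂ} (hz : z ∉ spec A) : eigSpace A z = ⊥ := by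
  rw [spec, Set.notMem_compl_iff] at hz
  obtain ⟨R, hR, -⟩ := hz
  rw [Submodule.eq_bot_iff]
  intro x hx
  obtain ⟨u, rfl, hu⟩ := mem_eigSpace.1 hx
  have := hR u
  rw [hu, sub_self, map_zero] at this
  exact this.symm

variable [CompleteSpace H]

theorem inner_map_eq_of_isSelfAdjoint {A : H →ₗ.[ℂ] H} (hA : IsSelfAdjoint A) (u v : A.domain) :
    ⟪A u, (v : H)⟫ = ⟪(u : H), A v⟫ := by
  have h := LinearPMap.adjoint_isFormalAdjoint hA.dense_domain
  rw [LinearPMap.isSelfAdjoint_def.1 hA] at h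
  exact h u v

theorem IsResolventAt.isSelfAdjoint {A : H →ₗ.[ℂ] H} (hA : IsSelfAdjoint A) {κ : ℝ}
    {R : H →L[ℂ] H} (hR : IsResolventAt A κ R) : IsSelfAdjoint R := by
  rw [ContinuousLinearMap.isSelfAdjoint_iff_isSymmetric]
  intro x y
  obtain ⟨u, hu, hx⟩ := hR.2 x
  obtain ⟨v, hv, hy⟩ := hR.2 y
  show ⟪R x, y⟫ = ⟪x, R y⟫
  rw [← hu, ← hv, ← hx, ← hy, inner_sub_left, inner_sub_right, inner_smul_left, inner_smul_right,
    inner_map_eq_of_isSelfAdjoint hA, Complex.conj_ofReal]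

/-- A self-adjoint bounded operator that is bounded below in norm is invertible. -/
theorem isUnit_of_isSelfAdjoint_of_le_norm {D : H →L[ℂ] H} (hD : IsSelfAdjoint D) {k : ℝ}
    (hk : 0 < k) (h : ∀ x, k * ‖x‖ ≤ ‖D x‖) : IsUnit D := by
  rw [ContinuousLinearMap.isUnit_iff_bijective,
    ContinuousLinearMap.bijective_iff_dense_range_and_antilipschitz]
  refine ⟨?_, ⟨k, hk.le⟩⁻¹, D.antilipschitz_of_bound fun x => ?_⟩
  · rw [Submodule.topologicalClosure_eq_top_iff, Submodule.eq_bot_iff]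
    intro x hx
    have h0 : ⟪D (D x), x⟫ = 0 := hx _ ⟨D x, rfl⟩
    have hs := (ContinuousLinearMap.isSelfAdjoint_iff_isSymmetric.1 hD) (D x) x
    have h1 : ⟪D x, D x⟫ = 0 := hs.symm.trans h0
    have h2 := h x
    rw [inner_self_eq_zero.1 h1, norm_zero] at h2
    have : ‖x‖ ≤ 0 := by
      by_contra! hc
      nlinarith
    exact norm_le_zero_iff.1 this
  · show ‖x‖ ≤ k⁻¹ * ‖D x‖
    rw [inv_mul_eq_div, le_div_iff₀ hk]
    linarith [h x]

/-- The spectrum of a semi-bounded self-adjoint operator is bounded below. The resolvent at a given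
point `a` replaces `A` by a bounded operator: `R - (t - a)⁻¹` is bounded below in norm. -/
theorem notMem_spec_of_lt {A : H →ₗ.[ℂ] H} (hA : IsSelfAdjoint A) {c : ℝ}
    (hc : ∀ u : A.domain, c * ‖(u : H)‖ ^ 2 ≤ (⟪(u : H), A u⟫).re) {a : ℝ}
    (ha : (a : ℂ) ∈ opResolventSet A) {t : ℝ} (ht : t < c) : (t : ℂ) ∉ spec A := by
  rw [spec, Set.notMem_compl_iff]
  by_cases hta : t = a
  · rwa [hta]
  obtain ⟨R, hR⟩ := ha
  have hw : t - a ≠ 0 := sub_ne_zero.2 hta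
  rw [hR.mem_opResolventSet_iff (by exact_mod_cast hta), ← Complex.ofReal_sub,
    ← Complex.ofReal_inv, spectrum.notMem_iff, Algebra.algebraMap_eq_smul_one]
  have hsa : IsSelfAdjoint ((((t - a)⁻¹ : ℝ) : ℂ) • (1 : H →L[ℂ] H) - R) := by
    refine IsSelfAdjoint.sub (IsSelfAdjoint.smul ?_ (IsSelfAdjoint.one _)) (hR.isSelfAdjoint hA)
    exact Complex.conj_ofReal _
  have hct : 0 < c - t := sub_pos.2 ht
  refine isUnit_of_isSelfAdjoint_of_le_norm (k := |t - a|⁻¹ / (1 + |t - a| / (c - t))) hsa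
    (by positivity) fun x => ?_
  obtain ⟨u, hu, hx⟩ := hR.2 x
  -- `‖(A - t) u‖` controls `‖u‖` by semi-boundedness, hence also `‖(A - a) u‖ = ‖x‖`.
  have h1 : (c - t) * ‖(u : H)‖ ≤ ‖A u - (t : ℂ) • (u : H)‖ := by
    have h2 : (⟪(u : H), A u - (t : ℂ) • (u : H)⟫).re ≤
        ‖(u : H)‖ * ‖A u - (t : ℂ) • (u : H)‖ := re_inner_le_norm (𝕜 := ℂ) _ _
    have h3 : (⟪(u : H), A u - (t : ℂ) • (u : H)⟫).re =
        (⟪(u : H), A u⟫).re - t * ‖(u : H)‖ ^ 2 := by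
      rw [inner_sub_right, inner_smul_right, inner_self_eq_norm_sq_to_K, Complex.sub_re,
        Complex.re_ofReal_mul]
      norm_cast
    have h4 := hc u
    rcases eq_or_lt_of_le (norm_nonneg (u : H)) with h0 | h0
    · rw [← h0]; simp
    · have : ‖(u : H)‖ * ((c - t) * ‖(u : H)‖) ≤ ‖(u : H)‖ * ‖A u - (t : ℂ) • (u : H)‖ := by
        nlinarith
      exact le_of_mul_le_mul_left this h0
  have h2 : ‖x‖ ≤ (1 + |t - a| / (c - t)) * ‖A u - (t : ℂ) • (u : H)‖ := by
    have h3 : x = (A u - (t : ℂ) • (u : H)) + (((t - a : ℝ) : ℂ)) • (u : H) := by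
      rw [← hx]; push_cast; module
    have h4 : ‖(u : H)‖ ≤ ‖A u - (t : ℂ) • (u : H)‖ / (c - t) := by
      rw [le_div_iff₀ hct]; linarith
    calc ‖x‖ ≤ ‖A u - (t : ℂ) • (u : H)‖ + |t - a| * ‖(u : H)‖ := by
          conv_lhs => rw [h3]
          refine (norm_add_le _ _).trans ?_
          rw [norm_smul, Complex.norm_real, Real.norm_eq_abs]
      _ ≤ ‖A u - (t : ℂ) • (u : H)‖ + |t - a| * (‖A u - (t : ℂ) • (u : H)‖ / (c - t)) := by gcongr
      _ = _ := by ring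
  have h3 : ((((t - a)⁻¹ : ℝ) : ℂ) • (1 : H →L[ℂ] H) - R) x =
      (((t - a)⁻¹ : ℝ) : ℂ) • (A u - (t : ℂ) • (u : H)) := by
    have hw' : (t : ℂ) - a ≠ 0 := by exact_mod_cast hw
    rw [sub_apply, smul_apply, one_apply_eq_self, ← hu, ← hx, ← sub_eq_zero, Complex.ofReal_inv,
      Complex.ofReal_sub]
    have : (u : H) = ((t : ℂ) - a)⁻¹ • (((t : ℂ) - a) • (u : H)) := by
      rw [smul_smul, inv_mul_cancel₀ hw', one_smul]
    nth_rewrite 2 [this]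
    rw [← smul_sub, ← smul_sub, show A u - (a : ℂ) • (u : H) - ((t : ℂ) - a) • (u : H) -
      (A u - (t : ℂ) • (u : H)) = 0 by module, smul_zero]
  rw [h3, norm_smul, Complex.norm_real, Real.norm_eq_abs, abs_inv, div_mul_eq_mul_div,
    div_le_iff₀ (by positivity), mul_assoc]
  gcongr
  linarith

end Unbounded

/-! ### The form domain and the Galerkin problem in bounded terms -/

section FormRoot

variable {H : Type*} [NormedAddCommGroup H] [InnerProductSpace ℂ H]

/-- The inversion `t ↦ (t - κ)⁻¹` carries the part of `[a, b]` above `κ + 1` into the interval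
`[(b - κ)⁻¹, (max a (κ + 1/2) - κ)⁻¹]`. Replacing `a` by `max a (κ + 1/2)` changes nothing above
`κ + 1` and keeps the denominator positive. -/
theorem iSup_Icc_eq_iSup_inv {a b κ : ℝ} (hb : κ < b)
    {f : ℝ → Submodule ℂ H} {g : ℝ → Submodule ℂ H} (hf0 : ∀ t < κ + 1, f t = ⊥)
    (hfg : ∀ t, κ < t → f t = g (t - κ)⁻¹) :
    ⨆ t ∈ Set.Icc a b, f t =
      ⨆ s ∈ Set.Icc (b - κ)⁻¹ (max a (κ + 1 / 2) - κ)⁻¹, g s := by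
  have hmax : κ + 1 / 2 ≤ max a (κ + 1 / 2) := le_max_right _ _
  refine le_antisymm (iSup₂_le fun t ht => ?_) (iSup₂_le fun s hs => ?_)
  · rcases lt_or_ge t (κ + 1) with h | h
    · rw [hf0 t h]; exact bot_le
    · rw [hfg t (by linarith)]
      have h1 : max a (κ + 1 / 2) ≤ t := max_le ht.1 (by linarith)
      refine le_iSup₂_of_le (t - κ)⁻¹ ⟨?_, ?_⟩ le_rfl
      · exact inv_anti₀ (by linarith) (by linarith [ht.2])
      · exact inv_anti₀ (by linarith) (by linarith)
  · have hs0 : 0 < s := lt_of_lt_of_le (inv_pos.2 (by linarith)) hs.1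
    have h1 := (inv_le_comm₀ (by linarith) hs0).1 hs.1
    have h2 := (le_inv_comm₀ hs0 (by linarith)).1 hs.2
    refine le_iSup₂_of_le (κ + s⁻¹) ⟨?_, ?_⟩ ?_
    · linarith [le_max_left a (κ + 1 / 2)]
    · linarith
    · rw [hfg _ (by linarith [inv_pos.2 hs0]), add_sub_cancel_left, inv_inv]

theorem re_inner_self (x : H) : (⟪x, x⟫).re = ‖x‖ ^ 2 := inner_self_eq_norm_sq (𝕜 := ℂ) x

/-- The Galerkin resolvent `(A_W - κ)⁻¹ Π_W` for the trial space `W = T X`, where `T` is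
`(A - κ)^{-1/2}`. -/
def ritzOp (T : H →L[ℂ] H) (X : Submodule ℂ H) [X.HasOrthogonalProjection] : H →L[ℂ] H :=
  T * X.starProjection * T

theorem ritzOp_apply (T : H →L[ℂ] H) (X : Submodule ℂ H) [X.HasOrthogonalProjection] (x : H) :
    ritzOp T X x = T (X.starProjection (T x)) := rfl

variable [CompleteSpace H]

/-- The operator `T` is `(A - κ)^{-1/2}` for `κ = min σ(A) - 1`: a self-adjoint contraction which
is an isometry of `H` onto the form domain with the norm `‖·‖_𝔞`. The last two fields say that
`sqrtShift A` is the inverse of `T`. -/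
structure FormRoot (A : H →ₗ.[ℂ] H) (κ : ℝ) (T : H →L[ℂ] H) : Prop where
  isResolventAt : IsResolventAt A κ (T * T)
  isSelfAdjoint : IsSelfAdjoint T
  norm_le_one : ‖T‖ ≤ 1
  specMin_eq : specMin A - 1 = κ
  notMem_spec : ∀ t : ℝ, t < κ + 1 → (t : ℂ) ∉ spec A
  mem_formDomain : ∀ u, u ∈ formDomain A ↔ ∃ x, T x = u
  sqrtShift_apply : ∀ (x : H) (hx : T x ∈ formDomain A), sqrtShift A ⟨T x, hx⟩ = x

/-- The square root `(A - κ)^{-1/2}` exists: `κ` lies below the spectrum of `A`, and the spectrum of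
the resolvent `(A - κ)⁻¹` lies in `[0, 1]`, since `s ≠ 0` in it gives `κ + 1 / s` in the spectrum
of `A`, which starts at `κ + 1`. -/
theorem exists_formRoot {A : H →ₗ.[ℂ] H} (hA : IsSelfAdjoint A) (hsemi : SemiboundedBelow A)
    {a : ℝ} (ha : (a : ℂ) ∈ opResolventSet A) :
    ∃ T, FormRoot A (specMin A - 1) T := by
  set κ := specMin A - 1 with hκ
  obtain ⟨c, hc⟩ := hsemi
  have hbdd : BddBelow {t : ℝ | (t : ℂ) ∈ spec A} :=
    ⟨c, fun t ht => not_lt.1 fun h => notMem_spec_of_lt hA hc ha h ht⟩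
  have hlt : ∀ t : ℝ, t < κ + 1 → (t : ℂ) ∉ spec A := fun t ht hs => by
    have : specMin A ≤ t := csInf_le hbdd hs
    linarith
  have hκ' : ∃ R : H →L[ℂ] H, IsResolventAt A (κ : ℂ) R := by
    have := hlt κ (by linarith)
    rwa [spec, Set.notMem_compl_iff] at this
  have hres : IsResolventAt A (κ : ℂ) (opResolvent A (κ : ℂ)) := by
    rw [opResolvent, dif_pos hκ']
    exact hκ'.choose_spec
  set R := opResolvent A (κ : ℂ) with hR
  have hRsa : IsSelfAdjoint R := hres.isSelfAdjoint hA
  have hspec : ∀ s ∈ spectrum ℝ R, 0 ≤ s ∧ s ≤ 1 := by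
    intro s hs
    by_contra hcon
    have hs0 : s ≠ 0 := by
      rintro rfl
      exact hcon ⟨le_rfl, zero_le_one⟩
    have hz : ((κ + s⁻¹ : ℝ) : ℂ) ≠ κ := by
      rw [Ne, Complex.ofReal_inj]
      simpa using hs0
    refine hlt (κ + s⁻¹) ?_ ?_
    · rcases lt_or_gt_of_ne hs0 with h | h
      · have := inv_lt_zero.2 h
        linarith
      · have h1 : 1 < s := by
          by_contra h1
          exact hcon ⟨h.le, not_lt.1 h1⟩
        have := inv_lt_one_of_one_lt₀ h1
        linarith
    · rw [spec, Set.mem_compl_iff, hres.mem_opResolventSet_iff hz, not_not,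
        show ((κ + s⁻¹ : ℝ) : ℂ) - κ = ((s⁻¹ : ℝ) : ℂ) by push_cast; ring, ← Complex.ofReal_inv,
        inv_inv]
      exact (spectrum.algebraMap_mem_iff ℂ).2 hs
  have hR0 : 0 ≤ R := by
    rw [StarOrderedRing.nonneg_iff_spectrum_nonneg (R := ℝ) R hRsa]
    exact fun s hs => (hspec s hs).1
  have hR1 : ‖R‖ ≤ 1 := by
    rw [← cfc_id' ℝ R]
    refine norm_cfc_le zero_le_one fun s hs => ?_
    rw [Real.norm_eq_abs, abs_le]
    have := hspec s hs
    constructor <;> linarith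
  set T := CFC.sqrt R with hT
  have hTT : T * T = R := CFC.sqrt_mul_sqrt_self R hR0
  have hTsa : IsSelfAdjoint T := (CFC.sqrt_nonneg R).isSelfAdjoint
  have hTinj : ∀ x, T x = 0 → x = 0 := by
    intro x hx
    refine hres.apply_eq_zero ?_
    rw [← hTT, mul_apply_eq_comp, hx, map_zero]
  have hker : (ofBounded T).toFun.ker = ⊥ := by
    rw [LinearMap.ker_eq_bot']
    intro x hx
    exact Subtype.ext (hTinj x hx)
  refine ⟨T, by rwa [hTT], hTsa, ?_, rfl, hlt, fun u => ?_, fun x hx => ?_⟩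
  · have h1 : ‖T‖ * ‖T‖ ≤ 1 := by
      rw [← CStarRing.norm_star_mul_self, hTsa.star_eq, hTT]
      exact hR1
    nlinarith [norm_nonneg T]
  · show u ∈ (ofBounded T).inverse.domain ↔ _
    rw [LinearPMap.inverse_domain]
    constructor
    · rintro ⟨x, rfl⟩
      exact ⟨x, rfl⟩
    · rintro ⟨x, rfl⟩
      exact ⟨⟨x, trivial⟩, rfl⟩
  · have := LinearPMap.inverse_apply_eq (f := ofBounded T) hker (y := ⟨T x, hx⟩)
      (x := ⟨x, trivial⟩) rfl
    exact this

theorem isSelfAdjoint_ritzOp {T : H →L[ℂ] H} (hT : IsSelfAdjoint T) (X : Submodule ℂ H)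
    [X.HasOrthogonalProjection] : IsSelfAdjoint (ritzOp T X) := by
  rw [IsSelfAdjoint, ritzOp, star_mul, star_mul, hT.star_eq,
    (isSelfAdjoint_starProjection X).star_eq, mul_assoc]

namespace FormRoot

variable {A : H →ₗ.[ℂ] H} {κ : ℝ} {T : H →L[ℂ] H} (hT : FormRoot A κ T)

include hT

theorem inner_apply_left (x y : H) : ⟪T x, y⟫ = ⟪x, T y⟫ :=
  ContinuousLinearMap.isSelfAdjoint_iff_isSymmetric.1 hT.isSelfAdjoint x y

theorem apply_eq_zero {x : H} (hx : T x = 0) : x = 0 :=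
  hT.isResolventAt.apply_eq_zero (by rw [mul_apply_eq_comp, hx, map_zero])

theorem injective : Function.Injective T :=
  (injective_iff_map_eq_zero T).2 fun _ hx => hT.apply_eq_zero hx

theorem norm_apply_le (x : H) : ‖T x‖ ≤ ‖x‖ := by
  simpa using T.le_of_opNorm_le hT.norm_le_one x

theorem apply_mem (x : H) : T x ∈ formDomain A := (hT.mem_formDomain _).2 ⟨x, rfl⟩

theorem form_apply (x y : H) (hx : T x ∈ formDomain A) (hy : T y ∈ formDomain A) :
    form A ⟨T x, hx⟩ ⟨T y, hy⟩ = ⟪y, x⟫ + κ * ⟪T y, T x⟫ := by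
  have h1 : form A ⟨T x, hx⟩ ⟨T y, hy⟩ = ⟪sqrtShift A ⟨T y, hy⟩, sqrtShift A ⟨T x, hx⟩⟫ +
      ((specMin A - 1 : ℝ) : ℂ) * ⟪T y, T x⟫ := rfl
  rw [h1, hT.specMin_eq]
  congr 2
  · exact hT.sqrtShift_apply y hy
  · exact hT.sqrtShift_apply x hx

theorem formNorm_apply (x : H) (hx : T x ∈ formDomain A) : formNorm A ⟨T x, hx⟩ = ‖x‖ := by
  rw [formNorm, hT.form_apply, hT.specMin_eq, Complex.add_re, Complex.re_ofReal_mul,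
    re_inner_self, re_inner_self, add_sub_cancel_right, Real.sqrt_sq (norm_nonneg x)]

theorem finiteDimensional_comap (W : Submodule ℂ H) [FiniteDimensional ℂ W] :
    FiniteDimensional ℂ (W.comap (T : H →ₗ[ℂ] H)) := by
  let f : W.comap (T : H →ₗ[ℂ] H) →ₗ[ℂ] W := (T : H →ₗ[ℂ] H).restrict fun _ hx => hx
  exact FiniteDimensional.of_injective f fun x y hxy =>
    Subtype.ext (hT.injective (congrArg Subtype.val hxy))

theorem map_comap {W : Submodule ℂ H} (hW : W ≤ formDomain A) :
    (W.comap (T : H →ₗ[ℂ] H)).map (T : H →ₗ[ℂ] H) = W := by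
  refine le_antisymm (Submodule.map_comap_le _ _) fun u hu => ?_
  obtain ⟨x, rfl⟩ := (hT.mem_formDomain u).1 (hW hu)
  exact ⟨x, hu, rfl⟩

section Galerkin

variable {W X : Submodule ℂ H} (hX : X.map (T : H →ₗ[ℂ] H) = W)

include hX

/-- The Galerkin problem in terms of lifts: `𝔞[T x, T y] - κ ⟨T x, T y⟩ = ⟨x, y⟩`. -/
theorem mem_galerkinEigSpace {μ : ℝ} {u : H} : u ∈ galerkinEigSpace A W μ ↔
    ∃ x ∈ X, T x = u ∧ ∀ y ∈ X, ⟪y, x⟫ = ((μ - κ : ℝ) : ℂ) * ⟪T y, T x⟫ := by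
  constructor
  · rintro ⟨huW, hu, h⟩
    rw [← hX] at huW
    obtain ⟨x, hx, rfl⟩ := huW
    refine ⟨x, hx, rfl, fun y hy => ?_⟩
    have h1 := h ⟨T y, hT.apply_mem y⟩ (by rw [← hX]; exact ⟨y, hy, rfl⟩)
    have h2 := hT.form_apply x y hu (hT.apply_mem y)
    rw [show (⟨T x, hu⟩ : formDomain A) = ⟨(T : H →ₗ[ℂ] H) x, hu⟩ from rfl, h1] at h2
    have h3 : (μ : ℂ) * ⟪T y, T x⟫ = ⟪y, x⟫ + κ * ⟪T y, T x⟫ := h2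
    push_cast
    linear_combination -h3
  · rintro ⟨x, hx, rfl, h⟩
    refine ⟨by rw [← hX]; exact ⟨x, hx, rfl⟩, hT.apply_mem x, ?_⟩
    rintro ⟨v, hv⟩ hvW
    rw [← hX] at hvW
    obtain ⟨y, hy, rfl⟩ := hvW
    have h1 := h y hy
    have h2 := hT.form_apply x y (hT.apply_mem x) hv
    refine h2.trans ?_
    rw [h1]
    push_cast
    show _ = (μ : ℂ) * ⟪T y, T x⟫
    ring

/-- Galerkin eigenvalues are at least `κ + 1`, because `‖u‖ ≤ ‖u‖_𝔞`. -/
theorem galerkinEigSpace_eq_bot {μ : ℝ} (hμ : μ < κ + 1) : galerkinEigSpace A W μ = ⊥ := by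
  rw [Submodule.eq_bot_iff]
  intro u hu
  obtain ⟨x, hx, rfl, h⟩ := (hT.mem_galerkinEigSpace hX).1 hu
  have h1 := congrArg Complex.re (h x hx)
  rw [Complex.re_ofReal_mul, re_inner_self, re_inner_self] at h1
  have h2 := hT.norm_apply_le x
  have h3 : ‖T x‖ ^ 2 ≤ ‖x‖ ^ 2 := by gcongr
  have h4 : ‖x‖ ^ 2 ≤ 0 := by
    by_contra! h4
    rcases le_or_gt (μ - κ) 0 with h5 | h5 <;> nlinarith [sq_nonneg ‖T x‖]
  have h5 : x = 0 := by simpa using le_antisymm h4 (sq_nonneg _)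
  rw [h5, map_zero]

/-- Galerkin eigenvectors are the eigenvectors of the Galerkin resolvent. -/
theorem galerkinEigSpace_eq [X.HasOrthogonalProjection] {μ : ℝ} (hμ : κ < μ) :
    galerkinEigSpace A W μ =
      Module.End.eigenspace (ritzOp T X : H →ₗ[ℂ] H) (((μ - κ)⁻¹ : ℝ) : ℂ) := by
  have hw : ((μ - κ : ℝ) : ℂ) ≠ 0 := by exact_mod_cast (sub_pos.2 hμ).ne'
  ext u
  rw [hT.mem_galerkinEigSpace hX, mem_eigenspace_iff, ritzOp_apply, Complex.ofReal_inv]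
  constructor
  · rintro ⟨x, hx, rfl, h⟩
    have h1 : ((μ - κ : ℝ) : ℂ)⁻¹ • x = X.starProjection (T (T x)) := by
      symm
      refine Submodule.eq_starProjection_of_mem_of_inner_eq_zero (X.smul_mem _ hx) fun y hy => ?_
      rw [← inner_conj_symm, inner_sub_right, inner_smul_right, h y hy, ← hT.inner_apply_left,
        inv_mul_cancel_left₀ hw, sub_self, map_zero]
    rw [← h1, map_smul]
  · intro h
    refine ⟨((μ - κ : ℝ) : ℂ) • X.starProjection (T u), X.smul_mem _ (by simp), ?_, ?_⟩
    · rw [map_smul, h, smul_inv_smul₀ hw]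
    · intro y hy
      have h1 : ((μ - κ : ℝ) : ℂ) • T (X.starProjection (T u)) = u := by rw [h, smul_inv_smul₀ hw]
      rw [map_smul, h1, inner_smul_right, hT.inner_apply_left,
        ← Submodule.inner_starProjection_left_eq_right, Submodule.starProjection_eq_self_iff.2 hy]

end Galerkin

theorem eigSpace_eq {t : ℝ} (ht : t ≠ κ) : eigSpace A (t : ℂ) =
    Module.End.eigenspace ((T * T : H →L[ℂ] H) : H →ₗ[ℂ] H) (((t - κ)⁻¹ : ℝ) : ℂ) := by
  rw [hT.isResolventAt.eigSpace_eq (by exact_mod_cast ht)]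
  push_cast
  rfl

theorem mem_spec_iff {z : ℂ} (hz : z ≠ κ) : z ∈ spec A ↔ (z - κ)⁻¹ ∈ spectrum ℂ (T * T) := by
  rw [spec, Set.mem_compl_iff, hT.isResolventAt.mem_opResolventSet_iff hz, not_not]

theorem mem_spec_ofReal_iff {t : ℝ} (ht : t ≠ κ) :
    (t : ℂ) ∈ spec A ↔ (t - κ)⁻¹ ∈ spectrum ℝ (T * T) := by
  rw [hT.mem_spec_iff (by exact_mod_cast ht), ← spectrum.algebraMap_mem_iff ℂ (R := ℝ),
    Complex.coe_algebraMap, Complex.ofReal_inv, Complex.ofReal_sub]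

end FormRoot

end FormRoot

/-! ### The spectrum in `[a, b]` under the inversion -/

/-- The image of the part of `[a, b]` above `κ + 1/2` under `t ↦ (t - κ)⁻¹`. -/
def invIcc (κ a b : ℝ) : Set ℝ := Set.Icc (b - κ)⁻¹ (max a (κ + 1 / 2) - κ)⁻¹

theorem mem_invIcc_iff {κ a b t : ℝ} (hb : κ < b) (ht : κ + 1 / 2 ≤ t) :
    (t - κ)⁻¹ ∈ invIcc κ a b ↔ t ∈ Set.Icc a b := by
  have hmax : κ + 1 / 2 ≤ max a (κ + 1 / 2) := le_max_right _ _
  rw [invIcc, Set.mem_Icc, Set.mem_Icc, inv_le_inv₀ (by linarith) (by linarith),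
    inv_le_inv₀ (by linarith) (by linarith), sub_le_sub_iff_right, sub_le_sub_iff_right, max_le_iff]
  tauto

theorem pos_of_mem_invIcc {κ a b s : ℝ} (hb : κ < b) (hs : s ∈ invIcc κ a b) : 0 < s :=
  lt_of_lt_of_le (inv_pos.2 (by linarith)) hs.1

theorem eigSpaceIcc_ne_bot {H : Type*} [NormedAddCommGroup H] [InnerProductSpace ℂ H]
    {A : H →ₗ.[ℂ] H} {a b : ℝ} (hess : ∀ t ∈ Set.Icc a b, (t : ℂ) ∉ essSpec A)
    (hne : ∃ t ∈ Set.Icc a b, (t : ℂ) ∈ spec A) :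
    eigSpaceIcc A a b ≠ ⊥ := by
  obtain ⟨t, ht, hts⟩ := hne
  have hd : (t : ℂ) ∈ discSpec A := by
    by_contra h
    exact hess t ht ⟨hts, h⟩
  intro h
  refine hd.2.2.1 (le_bot_iff.1 (h ▸ ?_))
  exact (le_iSup₂_of_le (f := fun (t : ℝ) (_ : t ∈ Set.Icc a b) => eigSpace A (t : ℂ)) t ht
    le_rfl).trans (Submodule.le_topologicalClosure _)

namespace FormRoot

variable {H : Type*} [NormedAddCommGroup H] [InnerProductSpace ℂ H] [CompleteSpace H]
variable {A : H →ₗ.[ℂ] H} {κ : ℝ} {T : H →L[ℂ] H} (hT : FormRoot A κ T)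

include hT

theorem galerkinSpace_eq {W X : Submodule ℂ H} [X.HasOrthogonalProjection]
    (hX : X.map (T : H →ₗ[ℂ] H) = W) {a b : ℝ} (hb : κ < b) :
    galerkinSpace A W a b = eigSum (ritzOp T X) (invIcc κ a b) :=
  iSup_Icc_eq_iSup_inv hb (fun _ ht => hT.galerkinEigSpace_eq_bot hX ht)
    (g := fun s => Module.End.eigenspace (ritzOp T X : H →ₗ[ℂ] H) (s : ℂ))
    fun _ ht => hT.galerkinEigSpace_eq hX ht

theorem iSup_eigSpace_eq {a b : ℝ} (hb : κ < b) :
    ⨆ t ∈ Set.Icc a b, eigSpace A (t : ℂ) = eigSum (T * T) (invIcc κ a b) :=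
  iSup_Icc_eq_iSup_inv hb (fun t ht => eigSpace_eq_bot (hT.notMem_spec t ht))
    (g := fun s => Module.End.eigenspace ((T * T : H →L[ℂ] H) : H →ₗ[ℂ] H) (s : ℂ))
    fun _ ht => hT.eigSpace_eq ht.ne'

theorem mem_spec_add_inv {s : ℝ} (hs : s ≠ 0) :
    ((κ + s⁻¹ : ℝ) : ℂ) ∈ spec A ↔ s ∈ spectrum ℝ (T * T) := by
  rw [hT.mem_spec_ofReal_iff (by simpa using hs), add_sub_cancel_left, inv_inv]

theorem mem_Icc_and_mem_spec_iff {a b t : ℝ} (hb : κ < b) :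
    (t ∈ Set.Icc a b ∧ (t : ℂ) ∈ spec A) ↔
      κ < t ∧ (t - κ)⁻¹ ∈ spectrum ℝ (T * T) ∩ invIcc κ a b := by
  constructor
  · rintro ⟨h1, h2⟩
    have h3 : κ + 1 ≤ t := not_lt.1 fun h => hT.notMem_spec t h h2
    exact ⟨by linarith, (hT.mem_spec_ofReal_iff (by linarith)).1 h2,
      (mem_invIcc_iff hb (by linarith)).2 h1⟩
  · rintro ⟨h1, h2, h3⟩
    have h4 := (hT.mem_spec_ofReal_iff h1.ne').2 h2
    have h5 : κ + 1 ≤ t := not_lt.1 fun h => hT.notMem_spec t h h4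
    exact ⟨(mem_invIcc_iff hb (by linarith)).1 h3, h4⟩

/-- A point of the spectrum of `(A - κ)⁻¹` in the inverted interval comes from the spectrum of `A`
in `[a, b]`. -/
theorem add_inv_mem {a b s : ℝ} (hb : κ < b) (hs : s ∈ spectrum ℝ (T * T) ∩ invIcc κ a b) :
    κ + s⁻¹ ∈ Set.Icc a b ∧ ((κ + s⁻¹ : ℝ) : ℂ) ∈ spec A := by
  have hs0 := pos_of_mem_invIcc hb hs.2
  rw [hT.mem_Icc_and_mem_spec_iff hb, add_sub_cancel_left, inv_inv]
  exact ⟨by linarith [inv_pos.2 hs0], hs⟩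

theorem isSelfAdjoint_mul_self : IsSelfAdjoint (T * T) := by
  rw [IsSelfAdjoint, star_mul, hT.isSelfAdjoint.star_eq]

section Interval

variable {a b : ℝ} (hess : ∀ t ∈ Set.Icc a b, (t : ℂ) ∉ essSpec A) (hκb : κ + 1 ≤ b)

include hκb in
/-- The ends of the inverted interval are not in the spectrum of `(A - κ)⁻¹`: they correspond to
`b`, and to `a` or a point below the spectrum of `A`. -/
theorem mem_Ioo_of_mem (ha : (a : ℂ) ∈ opResolventSet A)
    (hb : (b : ℂ) ∈ opResolventSet A) {s : ℝ} (hs : s ∈ spectrum ℝ (T * T) ∩ invIcc κ a b) :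
    s ∈ Set.Ioo (b - κ)⁻¹ (max a (κ + 1 / 2) - κ)⁻¹ := by
  have hmax : κ + 1 / 2 ≤ max a (κ + 1 / 2) := le_max_right _ _
  refine ⟨lt_of_le_of_ne hs.2.1 ?_, lt_of_le_of_ne hs.2.2 ?_⟩
  · rintro rfl
    exact (hT.mem_spec_ofReal_iff (by linarith)).2 hs.1 hb
  · rintro rfl
    have h1 := (hT.mem_spec_ofReal_iff (by linarith)).2 hs.1
    rcases max_cases a (κ + 1 / 2) with h | h
    · rw [h.1] at h1
      exact h1 ha
    · rw [h.1] at h1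
      exact hT.notMem_spec _ (by linarith) h1

include hess hκb

theorem add_inv_mem_discSpec {s : ℝ} (hs : s ∈ spectrum ℝ (T * T) ∩ invIcc κ a b) :
    ((κ + s⁻¹ : ℝ) : ℂ) ∈ discSpec A := by
  obtain ⟨h1, h2⟩ := hT.add_inv_mem (by linarith) hs
  by_contra h
  exact hess _ h1 ⟨h2, h⟩

theorem isolated_spectrum {s : ℝ} (hs : s ∈ spectrum ℝ (T * T) ∩ invIcc κ a b) :
    ∃ ε > 0, ∀ s' ∈ spectrum ℝ (T * T), |s' - s| < ε → s' = s := by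
  obtain ⟨-, ⟨δ, hδ, hiso⟩, -⟩ := hT.add_inv_mem_discSpec hess hκb hs
  have hs0 : s ≠ 0 := (pos_of_mem_invIcc (by linarith) hs.2).ne'
  have hcont : ContinuousAt (fun s' : ℝ => κ + s'⁻¹) s := by fun_prop (disch := exact hs0)
  have h1 := hcont.eventually (Metric.ball_mem_nhds _ hδ)
  have h2 := h1.and (isOpen_ne.mem_nhds hs0)
  obtain ⟨ε, hε, h⟩ := Metric.eventually_nhds_iff.1 h2
  refine ⟨ε, hε, fun s' hs' hlt => ?_⟩
  obtain ⟨h3, h4⟩ := h (by rwa [Real.dist_eq])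
  have h5 := hiso _ ((hT.mem_spec_add_inv h4).2 hs') (by
    rw [← Complex.ofReal_sub, Complex.norm_real, ← dist_eq_norm]
    exact h3)
  have h6 : κ + s'⁻¹ = κ + s⁻¹ := by exact_mod_cast h5
  exact inv_injective (add_left_cancel h6)

/-- A compact set of isolated points is finite. -/
theorem finite_spectrum_inter : (spectrum ℝ (T * T) ∩ invIcc κ a b).Finite := by
  have hc : IsCompact (spectrum ℝ (T * T) ∩ invIcc κ a b) :=
    (spectrum.isCompact (𝕜 := ℝ) (T * T)).inter_right isClosed_Icc
  by_contra hinf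
  obtain ⟨s, hs, hacc⟩ := Set.Infinite.exists_accPt_of_subset_isCompact hinf hc subset_rfl
  obtain ⟨ε, hε, h⟩ := hT.isolated_spectrum hess hκb hs
  obtain ⟨y, ⟨hy1, hy2⟩, hne⟩ := accPt_iff_nhds.1 hacc _ (Metric.ball_mem_nhds s hε)
  exact hne (h y hy2.1 (by simpa [Real.dist_eq] using hy1))

theorem splitsSpectrum_invIcc : SplitsSpectrum (T * T) (invIcc κ a b) :=
  splitsSpectrum_of_isolated (hT.finite_spectrum_inter hess hκb) fun _ hs =>
    hT.isolated_spectrum hess hκb hs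

theorem finiteDimensional_eigSum : FiniteDimensional ℂ (eigSum (T * T) (invIcc κ a b)) := by
  have hfin := hT.finite_spectrum_inter hess hκb
  have hle : eigSum (T * T) (invIcc κ a b) ≤ ⨆ s : hfin.toFinset,
      Module.End.eigenspace ((T * T : H →L[ℂ] H) : H →ₗ[ℂ] H) ((s : ℝ) : ℂ) := by
    refine iSup₂_le fun s hs => ?_
    by_cases h : s ∈ spectrum ℝ (T * T)
    · exact le_iSup (fun s : hfin.toFinset =>
        Module.End.eigenspace ((T * T : H →L[ℂ] H) : H →ₗ[ℂ] H) ((s : ℝ) : ℂ))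
        ⟨s, hfin.mem_toFinset.2 ⟨h, hs⟩⟩
    · have hs0 : s ≠ 0 := (pos_of_mem_invIcc (by linarith) hs).ne'
      have h1 := hT.eigSpace_eq (t := κ + s⁻¹) (by simpa using hs0)
      rw [add_sub_cancel_left, inv_inv,
        eigSpace_eq_bot (mt (hT.mem_spec_add_inv hs0).1 h)] at h1
      rw [← h1]
      exact bot_le
  have : ∀ s : hfin.toFinset, FiniteDimensional ℂ
      (Module.End.eigenspace ((T * T : H →L[ℂ] H) : H →ₗ[ℂ] H) ((s : ℝ) : ℂ)) := by
    intro s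
    have hs := hfin.mem_toFinset.1 s.2
    have hs0 : (s : ℝ) ≠ 0 := (pos_of_mem_invIcc (by linarith) hs.2).ne'
    have h1 := hT.eigSpace_eq (t := κ + (s : ℝ)⁻¹) (by simpa using hs0)
    rw [add_sub_cancel_left, inv_inv] at h1
    rw [← h1]
    exact (hT.add_inv_mem_discSpec hess hκb hs).2.2.2
  exact Submodule.finiteDimensional_of_le hle

/-- The space `L(Δ)` as the span of eigenspaces of the resolvent; it is finite-dimensional, so no
closure is needed. -/
theorem eigSpaceIcc_eq : eigSpaceIcc A a b = eigSum (T * T) (invIcc κ a b) := by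
  have := hT.finiteDimensional_eigSum hess hκb
  rw [eigSpaceIcc, hT.iSup_eigSpace_eq (by linarith)]
  exact (Submodule.closed_of_finiteDimensional _).submodule_topologicalClosure_eq

end Interval

end FormRoot

/-! ### Strong convergence of spectral projections -/

section Strong

variable {H : Type*} [NormedAddCommGroup H] [InnerProductSpace ℂ H]

/-- Strong convergence is uniform on a finite-dimensional space. -/
theorem tendsto_norm_mul_starProjection {D : ℕ → H →L[ℂ] H} (V : Submodule ℂ H)
    [FiniteDimensional ℂ V] (hD : ∀ x ∈ V, Tendsto (fun n => D n x) atTop (𝓝 0)) :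
    Tendsto (fun n => ‖D n * V.starProjection‖) atTop (𝓝 0) := by
  let e := stdOrthonormalBasis ℂ V
  have h1 : ∀ n, ‖D n * V.starProjection‖ ≤ ∑ i, ‖D n (e i)‖ := by
    intro n
    refine ContinuousLinearMap.opNorm_le_bound _ (by positivity) fun x => ?_
    have h2 : V.starProjection x = ∑ i, ⟪e i, V.orthogonalProjectionOnto x⟫ • (e i : H) := by
      have := congrArg (fun v : V => (v : H)) (e.sum_repr' (V.orthogonalProjectionOnto x))
      simpa using this.symm
    rw [mul_apply_eq_comp, h2, map_sum, Finset.sum_mul]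
    refine (norm_sum_le _ _).trans (Finset.sum_le_sum fun i _ => ?_)
    rw [map_smul, norm_smul, mul_comm]
    gcongr
    refine (norm_inner_le_norm _ _).trans ?_
    rw [e.orthonormal.1 i, one_mul]
    exact V.norm_orthogonalProjectionOnto_apply_le x
  refine squeeze_zero (fun n => norm_nonneg _) h1 ?_
  have h3 := tendsto_finsetSum Finset.univ fun i _ => (hD (e i) (e i).2).norm
  simpa using h3

variable [CompleteSpace H]

/-- An open interval that contains the part of the spectrum in its closure is strictly closer to
its midpoint than the rest of the spectrum. -/
theorem exists_gap_of_Icc {R : H →L[ℂ] H} {α β : ℝ}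
    (hI : ∀ s ∈ spectrum ℝ R ∩ Set.Icc α β, s ∈ Set.Ioo α β) :
    ∃ r' > (β - α) / 2, ∀ s ∈ spectrum ℝ R ∩ (Set.Icc α β)ᶜ, r' ≤ |s - (α + β) / 2| := by
  have heq : spectrum ℝ R ∩ (Set.Icc α β)ᶜ = spectrum ℝ R ∩ (Set.Ioo α β)ᶜ := by
    ext s
    refine ⟨fun h => ⟨h.1, fun h' => h.2 (Set.Ioo_subset_Icc_self h')⟩,
      fun h => ⟨h.1, fun h' => ?_⟩⟩
    exact h.2 (hI s ⟨h.1, h'⟩)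
  have hc : IsCompact (spectrum ℝ R ∩ (Set.Icc α β)ᶜ) := by
    rw [heq]
    exact (spectrum.isCompact (𝕜 := ℝ) R).inter_right isOpen_Ioo.isClosed_compl
  rcases (spectrum ℝ R ∩ (Set.Icc α β)ᶜ).eq_empty_or_nonempty with h0 | h0
  · exact ⟨(β - α) / 2 + 1, by linarith, by simp [h0]⟩
  · obtain ⟨s, hs, hmin⟩ := hc.exists_isMinOn h0
      (f := fun s => |s - (α + β) / 2|) (by fun_prop)
    refine ⟨|s - (α + β) / 2|, ?_, fun t ht => hmin ht⟩
    by_contra! hle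
    obtain ⟨h1, h2⟩ := abs_le.1 hle
    exact hs.2 ⟨by linarith, by linarith⟩

/-- If self-adjoint `S n` converge strongly to `R` and the ends of `[α, β]` are not in the spectrum
of `R`, which is discrete in `[α, β]`, then the spectral projections for `[α, β]` converge strongly.

On the range of the limit projection this is the bound `δ ‖(1 - Q n) e‖ ≤ ‖(S n - t) e‖` for an
eigenvector `e` with eigenvalue `t`. A vector `x` in its kernel is `(R - c) y` with
`‖y‖ ≤ ‖x‖ / r'`, where `c` is the midpoint, while `S n - c` is bounded by `r < r'` on the range of
`Q n`; iterating this, `limsup ‖Q n x‖ ≤ (r / r') ^ k ‖x‖` for all `k`. -/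
theorem tendsto_specProj_apply {R : H →L[ℂ] H} {S : ℕ → H →L[ℂ] H} (hR : IsSelfAdjoint R)
    (hS : ∀ n, IsSelfAdjoint (S n)) (hlim : ∀ x, Tendsto (fun n => S n x) atTop (𝓝 (R x)))
    {α β : ℝ} (hI : ∀ s ∈ spectrum ℝ R ∩ Set.Icc α β, s ∈ Set.Ioo α β)
    (hJ : SplitsSpectrum R (Set.Icc α β)) (hfin : (spectrum ℝ R ∩ Set.Icc α β).Finite)
    (hSfin : ∀ n, (spectrum ℝ (S n)).Finite) (x : H) :
    Tendsto (fun n => specProj (S n) (Set.Icc α β) x) atTop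
      (𝓝 (specProj R (Set.Icc α β) x)) := by
  set J := Set.Icc α β with hJdef
  have hSJ : ∀ n, SplitsSpectrum (S n) J := fun n => splitsSpectrum_of_finite (hSfin n) J
  have hQ1 : ∀ n x, ‖specProj (S n) J x‖ ≤ ‖x‖ := fun n x => by
    have : ‖specProj (S n) J‖ ≤ 1 := norm_cutoff_le zero_le_one fun s _ => by simp
    simpa using (specProj (S n) J).le_of_opNorm_le this x
  have hdiff : ∀ x, Tendsto (fun n => ‖R x - S n x‖) atTop (𝓝 0) := fun x => by
    simpa using ((tendsto_const_nhds (x := R x)).sub (hlim x)).norm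
  -- convergence on the range of the limit projection
  have hrange : ∀ y ∈ eigSum R J, Tendsto (fun n => specProj (S n) J y) atTop (𝓝 y) := by
    let N : Submodule ℂ H :=
      { carrier := {y | Tendsto (fun n => specProj (S n) J y) atTop (𝓝 y)}
        zero_mem' := by simp
        add_mem' := fun {y z} hy hz => by
          simp only [Set.mem_ofPred_eq, map_add] at hy hz ⊢
          exact hy.add hz
        smul_mem' := fun c {y} hy => by
          simp only [Set.mem_ofPred_eq, map_smul] at hy ⊢
          exact hy.const_smul c }
    suffices h : eigSum R J ≤ N from fun y hy => h hy
    refine iSup₂_le fun t ht e he => ?_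
    rw [mem_eigenspace_iff] at he
    by_cases he0 : e = 0
    · rw [he0]; exact N.zero_mem
    have hts : t ∈ spectrum ℝ R := mem_spectrum_of_apply_eq he0 he
    obtain ⟨h1, h2⟩ := hI t ⟨hts, ht⟩
    have hδ : 0 < min (t - α) (β - t) := lt_min (by linarith) (by linarith)
    have hfar : ∀ n, ∀ s ∈ spectrum ℝ (S n) ∩ Jᶜ, min (t - α) (β - t) ≤ |s - t| := by
      rintro n s ⟨-, hs⟩
      by_contra! hlt
      obtain ⟨h3, h4⟩ := abs_lt.1 hlt
      exact hs ⟨by linarith [min_le_left (t - α) (β - t)],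
        by linarith [min_le_right (t - α) (β - t)]⟩
    have h3 : ∀ n, ‖e - specProj (S n) J e‖ ≤ (min (t - α) (β - t))⁻¹ * ‖R e - S n e‖ := by
      intro n
      have := le_norm_sub_smul hδ (hfar n) (hS n) (hSJ n).compl e
      rw [specProj_compl (hS n) (hSJ n), ← he, norm_sub_rev] at this
      rw [inv_mul_eq_div, le_div_iff₀ hδ, mul_comm]
      exact this
    have h4 : Tendsto (fun n => e - specProj (S n) J e) atTop (𝓝 0) := by
      refine squeeze_zero_norm h3 ?_
      simpa using (hdiff e).const_mul (min (t - α) (β - t))⁻¹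
    have h5 := (tendsto_const_nhds (x := e)).sub h4
    rw [sub_zero] at h5
    simp only [sub_sub_cancel] at h5
    exact h5
  -- convergence on the kernel of the limit projection
  obtain ⟨r', hr', hfar⟩ := exists_gap_of_Icc hI
  have hker : ∀ y, specProj R J y = 0 → Tendsto (fun n => specProj (S n) J y) atTop (𝓝 0) := by
    intro y hy
    rcases lt_or_ge β α with hαβ | hαβ
    · have : J = ∅ := Set.Icc_eq_empty (not_le.2 hαβ)
      have h0 : ∀ n, specProj (S n) J = 0 := fun n => by
        rw [this, specProj, cutoff, Set.indicator_empty]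
        exact cfc_const_zero ℝ (S n)
      simp [h0]
    set c := (α + β) / 2 with hc
    set r := (β - α) / 2 with hr
    have hr0 : 0 ≤ r := by rw [hr]; linarith
    have hr'0 : 0 < r' := by linarith
    have hstep : ∀ n y, ‖specProj (S n) J (S n y - (c : ℂ) • y)‖ ≤ r * ‖specProj (S n) J y‖ := by
      intro n y
      rw [specProj_apply_sub_smul (hS n) (hSJ n)]
      refine norm_sub_smul_le (hS n) (hSJ n) hr0 (fun s hs => ?_) ?_
      · rw [abs_le]
        obtain ⟨-, h3, h4⟩ := hs
        constructor <;> linarith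
      · exact specProj_specProj (hSJ n) y
    have hiter : ∀ k : ℕ, ∀ y, specProj R J y = 0 → ∀ ε > 0, ∀ᶠ n in atTop,
        ‖specProj (S n) J y‖ ≤ (r / r') ^ k * ‖y‖ + ε := by
      intro k
      induction k with
      | zero =>
        intro y _ ε hε
        refine Eventually.of_forall fun n => ?_
        rw [pow_zero, one_mul]
        linarith [hQ1 n y]
      | succ k ih =>
        intro y hy ε hε
        -- `y = (R - c) z` with `z` again in the kernel of the projection
        set z := partialInverse R Jᶜ c y with hz
        have hzy : R z - (c : ℂ) • z = y := by
          have := congrArg (fun T : H →L[ℂ] H => T y)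
            (sub_smul_mul_partialInverse hr'0 hfar hR hJ.compl)
          rw [specProj_compl hR hJ] at this
          simpa [hy] using this
        have hz0 : specProj R J z = 0 := by
          have := congrArg (fun T : H →L[ℂ] H => T y)
            (specProj_mul_partialInverse hr'0 hfar hJ.compl)
          rw [specProj_compl hR hJ] at this
          simpa [← hz] using this
        have hzn : ‖z‖ ≤ r'⁻¹ * ‖y‖ :=
          (partialInverse R Jᶜ c).le_of_opNorm_le (norm_partialInverse_le hr'0 hfar) y
        have hε' : 0 < ε / (2 * (r + 1)) := by positivity
        filter_upwards [ih z hz0 _ hε', (hdiff z).eventually_le_const (half_pos hε)] with n h1 h2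
        have h3 : specProj (S n) J y =
            specProj (S n) J (R z - S n z) + specProj (S n) J (S n z - (c : ℂ) • z) := by
          rw [← map_add, sub_add_sub_cancel, hzy]
        have h4 : r * (ε / (2 * (r + 1))) ≤ ε / 2 := by
          rw [mul_div_assoc', div_le_div_iff₀ (by positivity) (by positivity)]
          nlinarith
        calc ‖specProj (S n) J y‖ ≤ ‖R z - S n z‖ + r * ‖specProj (S n) J z‖ := by
              rw [h3]
              exact (norm_add_le _ _).trans (add_le_add (hQ1 _ _) (hstep _ _))
          _ ≤ ε / 2 + r * ((r / r') ^ k * (r'⁻¹ * ‖y‖) + ε / (2 * (r + 1))) := by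
              gcongr
              exact h1.trans (by gcongr)
          _ = ε / 2 + (r / r') ^ (k + 1) * ‖y‖ + r * (ε / (2 * (r + 1))) := by
              rw [pow_succ]; ring
          _ ≤ _ := by linarith
    rw [Metric.tendsto_nhds]
    intro ε hε
    have hq : r / r' < 1 := (div_lt_one hr'0).2 hr'
    have hk := ((tendsto_pow_atTop_nhds_zero_of_lt_one (by positivity) hq).mul_const ‖y‖)
    rw [zero_mul] at hk
    obtain ⟨k, hk⟩ := (hk.eventually_lt_const (half_pos hε)).exists
    filter_upwards [hiter k y hy (ε / 2) (half_pos hε)] with n hn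
    rw [dist_zero_right]
    linarith
  have h1 := hrange (specProj R J x) (by
    rw [← range_specProj hR hJ hfin]
    exact ⟨x, rfl⟩)
  have h2 := hker (x - specProj R J x) (by
    rw [map_sub, sub_eq_zero]
    exact (specProj_specProj hJ x).symm)
  have h3 := h1.add h2
  simp only [← map_add, add_sub_cancel, add_zero] at h3
  exact h3

end Strong

/-! ### Compressions of a projection -/

section Compression

variable {H : Type*} [NormedAddCommGroup H] [InnerProductSpace ℂ H]

/-- The operator `Q P Q` on `H` for the orthogonal projections `Q` onto `V` and `P` onto `L`. -/
def compressionOp (V L : Submodule ℂ H) [V.HasOrthogonalProjection] [L.HasOrthogonalProjection] :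
    H →L[ℂ] H :=
  V.starProjection * L.starProjection * V.starProjection

theorem compressionOp_mem (V L : Submodule ℂ H) [V.HasOrthogonalProjection]
    [L.HasOrthogonalProjection] (x : H) : compressionOp V L x ∈ V :=
  Submodule.starProjection_apply_mem _ _

theorem finite_spectrum_compressionOp (V L : Submodule ℂ H) [V.HasOrthogonalProjection]
    [L.HasOrthogonalProjection] [FiniteDimensional ℂ V] :
    (spectrum ℝ (compressionOp V L)).Finite :=
  finite_spectrum_of_range_le V (compressionOp_mem V L)

theorem re_inner_compressionOp (V L : Submodule ℂ H) [V.HasOrthogonalProjection]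
    [L.HasOrthogonalProjection] {u : H} (hu : u ∈ V) :
    (⟪compressionOp V L u, u⟫).re = ‖L.starProjection u‖ ^ 2 := by
  have h : compressionOp V L u = V.starProjection (L.starProjection u) := by
    show V.starProjection (L.starProjection (V.starProjection u)) = _
    rw [Submodule.starProjection_eq_self_iff.2 hu]
  rw [h, Submodule.inner_starProjection_left_eq_right, Submodule.starProjection_eq_self_iff.2 hu,
    ← re_inner_self, Submodule.inner_starProjection_left_eq_right,
    Submodule.inner_starProjection_left_eq_right,
    show L.starProjection (L.starProjection u) = L.starProjection u from
      congrArg (fun T : H →L[ℂ] H => T u) L.isIdempotentElem_starProjection]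

theorem mem_spec_ofBounded_iff (B : H →L[ℂ] H) (z : ℂ) :
    z ∈ spec (ofBounded B) ↔ z ∈ spectrum ℂ B := by
  rw [spec, Set.mem_compl_iff, ← not_iff_not, not_not, spectrum.notMem_iff,
    Algebra.algebraMap_eq_smul_one, ← IsUnit.neg_iff, neg_sub]
  constructor
  · rintro ⟨R, h1, h2⟩
    refine ⟨⟨B - z • 1, R, ?_, ?_⟩, rfl⟩
    · ext x
      obtain ⟨u, hu, hx⟩ := h2 x
      rw [hu] at hx
      have h3 : B (u : H) - z • R x = x := hx
      rw [hu] at h3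
      exact h3
    · ext x
      exact h1 ⟨x, trivial⟩
  · rintro ⟨⟨D, R, hDR, hRD⟩, rfl : D = _⟩
    refine ⟨R, fun u => ?_, fun x => ⟨⟨R x, trivial⟩, rfl, ?_⟩⟩
    · exact congrArg (fun T : H →L[ℂ] H => T (u : H)) hRD
    · exact congrArg (fun T : H →L[ℂ] H => T x) hDR

theorem mem_eigSpace_ofBounded_iff (B : H →L[ℂ] H) (z : ℂ) (x : H) :
    x ∈ eigSpace (ofBounded B) z ↔ B x = z • x := by
  rw [mem_eigSpace]
  constructor
  · rintro ⟨u, rfl, h⟩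
    exact h
  · intro h
    exact ⟨⟨x, trivial⟩, rfl, h⟩

/-- The filtered space in terms of the compression extended by `0` to all of `H`; the extension only
adds the eigenvalue `0`. -/
theorem filteredSpace_eq [CompleteSpace H] (V L : Submodule ℂ H) [FiniteDimensional ℂ V]
    [FiniteDimensional ℂ L] {s t : ℝ} (hs : 0 < s) :
    filteredSpace V L s t = eigSum (compressionOp V L) (Set.Icc s t) := by
  simp only [filteredSpace, eigSum, Submodule.map_iSup]
  refine iSup_congr fun μ => iSup_congr fun hμ => ?_
  have hμ0 : (μ : ℂ) ≠ 0 := by exact_mod_cast (hs.trans_le hμ.1).ne'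
  have hc : ∀ v : V, ((compression V L v : V) : H) = compressionOp V L v := by
    intro v
    show V.starProjection (L.starProjection v) =
      V.starProjection (L.starProjection (V.starProjection v))
    rw [Submodule.starProjection_eq_self_iff.2 v.2]
  ext x
  rw [mem_eigenspace_iff, Submodule.mem_map]
  constructor
  · rintro ⟨v, hv, rfl⟩
    rw [Module.End.mem_eigenspace_iff] at hv
    rw [Submodule.subtype_apply, ← hc, hv]
    rfl
  · intro hx
    have hxV : x ∈ V := by
      have h1 := V.smul_mem (μ : ℂ)⁻¹ (compressionOp_mem V L x)
      rwa [hx, inv_smul_smul₀ hμ0] at h1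
    refine ⟨⟨x, hxV⟩, ?_, rfl⟩
    rw [Module.End.mem_eigenspace_iff]
    exact Subtype.ext ((hc _).trans hx)

variable [CompleteSpace H]

section

variable (V L : Submodule ℂ H) [V.HasOrthogonalProjection] [L.HasOrthogonalProjection]

theorem compressionOp_nonneg : 0 ≤ compressionOp V L := by
  have h : compressionOp V L =
      star (L.starProjection * V.starProjection) * (L.starProjection * V.starProjection) := by
    rw [star_mul, (isSelfAdjoint_starProjection V).star_eq,
      (isSelfAdjoint_starProjection L).star_eq, compressionOp, mul_assoc, mul_assoc,
      ← mul_assoc L.starProjection L.starProjection, L.isIdempotentElem_starProjection.eq]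
  rw [h]
  exact star_mul_self_nonneg _

theorem isSelfAdjoint_compressionOp : IsSelfAdjoint (compressionOp V L) :=
  (compressionOp_nonneg V L).isSelfAdjoint

theorem norm_compressionOp_le : ‖compressionOp V L‖ ≤ 1 := by
  have h1 := V.starProjection_norm_le
  have h2 := L.starProjection_norm_le
  calc ‖compressionOp V L‖ ≤ ‖V.starProjection‖ * ‖L.starProjection‖ * ‖V.starProjection‖ :=
        (norm_mul_le _ _).trans (by gcongr; exact norm_mul_le _ _)
    _ ≤ 1 * 1 * 1 := by gcongr
    _ = 1 := by norm_num

theorem spectrum_compressionOp_subset {s : ℝ} (hs : s ∈ spectrum ℝ (compressionOp V L)) :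
    0 ≤ s ∧ s ≤ 1 := by
  have hsa := isSelfAdjoint_compressionOp V L
  refine ⟨(StarOrderedRing.nonneg_iff_spectrum_nonneg (R := ℝ) _ hsa).1
    (compressionOp_nonneg V L) s hs, ?_⟩
  have h1 := norm_apply_le_norm_cfc (fun x : ℝ => x) (compressionOp V L) hs
  rw [cfc_id' ℝ (compressionOp V L)] at h1
  exact (le_abs_self s).trans (h1.trans (norm_compressionOp_le V L))

end

theorem exists_eigenvector_of_finite_spectrum {B : H →L[ℂ] H} (hB : IsSelfAdjoint B)
    (hfin : (spectrum ℝ B).Finite) {s : ℝ} (hs : s ∈ spectrum ℝ B) :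
    ∃ x : H, x ≠ 0 ∧ B x = (s : ℂ) • x := by
  by_contra! hcon
  have hsplit := splitsSpectrum_of_finite hfin {s}
  have h0 : specProj B {s} = 0 := by
    ext x
    have h1 := specProj_apply_mem hB hsplit (hfin.inter_of_left _) x
    simp only [eigSum, Set.mem_singleton_iff, iSup_iSup_eq_left, mem_eigenspace_iff] at h1
    by_contra h2
    exact hcon _ h2 h1
  have h1 : cfc (Set.indicator {s} 1) B = cfc (fun _ : ℝ => (0 : ℝ)) B := by
    rw [cfc_const_zero]
    exact h0
  have h2 := eqOn_of_cfc_eq_cfc h1 (hsplit.continuousOn_indicator continuous_one.continuousOn)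
    continuousOn_const hB hs
  simp at h2

/-- For a finite-rank self-adjoint operator on an infinite-dimensional space, the discrete spectrum
is the spectrum without `0`. -/
theorem mem_discSpec_ofBounded_iff (hdim : ¬ FiniteDimensional ℂ H) {B : H →L[ℂ] H}
    (hB : IsSelfAdjoint B) (V : Submodule ℂ H) [FiniteDimensional ℂ V] (hV : ∀ x, B x ∈ V)
    (t : ℝ) : (t : ℂ) ∈ discSpec (ofBounded B) ↔ t ∈ spectrum ℝ B ∧ t ≠ 0 := by
  have hfin : (spectrum ℝ B).Finite := finite_spectrum_of_range_le V hV
  have hspec : ∀ s : ℝ, (s : ℂ) ∈ spec (ofBounded B) ↔ s ∈ spectrum ℝ B := fun s => by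
    rw [mem_spec_ofBounded_iff]
    exact spectrum.algebraMap_mem_iff ℂ (R := ℝ) (r := s)
  constructor
  · rintro ⟨h1, -, -, h2⟩
    refine ⟨(hspec t).1 h1, ?_⟩
    rintro rfl
    -- the kernel of a finite-rank operator on an infinite-dimensional space is infinite-dimensional
    refine hdim ?_
    have hker : eigSpace (ofBounded B) ((0 : ℝ) : ℂ) = LinearMap.ker (B : H →ₗ[ℂ] H) := by
      ext x
      rw [mem_eigSpace_ofBounded_iff, LinearMap.mem_ker]
      simp
    rw [hker] at h2
    have hr : FiniteDimensional ℂ (LinearMap.range (B : H →ₗ[ℂ] H)) :=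
      Submodule.finiteDimensional_of_le (S₂ := V) (by rintro _ ⟨x, rfl⟩; exact hV x)
    have hq : FiniteDimensional ℂ (H ⧸ LinearMap.ker (B : H →ₗ[ℂ] H)) :=
      Module.Finite.equiv (LinearMap.quotKerEquivRange (B : H →ₗ[ℂ] H)).symm
    exact Module.Finite.of_submodule_quotient (LinearMap.ker (B : H →ₗ[ℂ] H))
  · rintro ⟨h1, h0⟩
    refine ⟨(hspec t).2 h1, ?_, ?_, ?_⟩
    · have h2 : (spectrum ℝ B \ {t})ᶜ ∈ 𝓝 t :=
        (hfin.subset Set.sdiff_subset).isClosed.isOpen_compl.mem_nhds fun h => h.2 rfl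
      obtain ⟨ε, hε, h⟩ := Metric.mem_nhds_iff.1 h2
      refine ⟨ε, hε, fun w hw hwt => ?_⟩
      rw [mem_spec_ofBounded_iff] at hw
      obtain ⟨s, rfl⟩ : ∃ s : ℝ, w = s := ⟨w.re, hB.mem_spectrum_eq_re hw⟩
      by_contra hne
      have hst : s ≠ t := fun h => hne (by rw [h])
      refine h (show s ∈ Metric.ball t ε from ?_)
        ⟨(hspec s).1 ((mem_spec_ofBounded_iff _ _).2 hw), hst⟩
      rw [Metric.mem_ball, Real.dist_eq, ← Real.norm_eq_abs, ← Complex.norm_real]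
      exact_mod_cast hwt
    · obtain ⟨x, hx0, hx⟩ := exists_eigenvector_of_finite_spectrum hB hfin h1
      intro hbot
      have := (mem_eigSpace_ofBounded_iff B t x).2 hx
      rw [hbot] at this
      exact hx0 this
    · refine Submodule.finiteDimensional_of_le (S₂ := V) fun x hx => ?_
      rw [mem_eigSpace_ofBounded_iff] at hx
      have h2 := V.smul_mem (t : ℂ)⁻¹ (hV x)
      rwa [hx, inv_smul_smul₀ (by exact_mod_cast h0)] at h2

/-- The least point `γ` of the discrete spectrum of `E P E` exists and is positive, as `P` is
injective on the range of `E`. -/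
theorem exists_isLeast_discSpec (hdim : ¬ FiniteDimensional ℂ H) (V L : Submodule ℂ H)
    [FiniteDimensional ℂ V] [L.HasOrthogonalProjection] (hV : V ≠ ⊥)
    (hinj : ∀ u ∈ V, L.starProjection u = 0 → u = 0) :
    ∃ γ : ℝ, IsLeast {t : ℝ | (t : ℂ) ∈ discSpec (ofBounded (compressionOp V L))} γ ∧ 0 < γ ∧
      ∀ s ∈ spectrum ℝ (compressionOp V L), s ≠ 0 → γ ≤ s := by
  have hB := isSelfAdjoint_compressionOp V L
  have hset : {t : ℝ | (t : ℂ) ∈ discSpec (ofBounded (compressionOp V L))} =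
      spectrum ℝ (compressionOp V L) \ {0} := by
    ext t
    exact mem_discSpec_ofBounded_iff hdim hB V (compressionOp_mem V L) t
  have hfin : (spectrum ℝ (compressionOp V L) \ {0}).Finite :=
    (finite_spectrum_compressionOp V L).subset Set.sdiff_subset
  have hne : (spectrum ℝ (compressionOp V L) \ {0}).Nonempty := by
    rw [Set.nonempty_iff_ne_empty]
    intro hempty
    have h0 : compressionOp V L = 0 := by
      refine CFC.eq_zero_of_spectrum_subset_zero (R := ℝ) _ ?_ hB
      rwa [Set.sdiff_eq_empty] at hempty
    obtain ⟨u, hu, hu0⟩ := Submodule.exists_mem_ne_zero_of_ne_bot hV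
    have h1 := re_inner_compressionOp V L hu
    rw [h0] at h1
    refine hu0 (hinj u hu ?_)
    simpa using h1.symm
  obtain ⟨γ, hγ⟩ : ∃ γ, IsLeast (spectrum ℝ (compressionOp V L) \ {0}) γ := by
    obtain ⟨γ, hγ, hmin⟩ := hfin.exists_minimalFor id _ hne
    refine ⟨γ, hγ, fun t ht => ?_⟩
    exact (le_total γ t).elim id fun h => hmin ht h
  refine ⟨γ, by rwa [hset], ?_, fun s hs hs0 => hγ.2 ⟨hs, hs0⟩⟩
  exact lt_of_le_of_ne (spectrum_compressionOp_subset V L hγ.1.1).1 (Ne.symm hγ.1.2)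

/-- The spectral projection of `E P E` for `[γ / 2, 1]` is `E` itself, as `E P E` is injective on
the range of `E`. -/
theorem specProj_compressionOp_eq {V L : Submodule ℂ H} [FiniteDimensional ℂ V]
    [L.HasOrthogonalProjection] (hinj : ∀ u ∈ V, L.starProjection u = 0 → u = 0) {γ : ℝ}
    (hγ : 0 < γ) (hmin : ∀ s ∈ spectrum ℝ (compressionOp V L), s ≠ 0 → γ ≤ s) :
    specProj (compressionOp V L) (Set.Icc (γ / 2) 1) = V.starProjection := by
  set B := compressionOp V L with hBdef
  set J := Set.Icc (γ / 2) 1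
  have hB : IsSelfAdjoint B := isSelfAdjoint_compressionOp V L
  have hfin : (spectrum ℝ B).Finite := finite_spectrum_compressionOp V L
  have hJ := splitsSpectrum_of_finite hfin J
  refine (starProjection_eq_specProj hB hJ (hfin.inter_of_left _) V ?_).symm
  refine le_antisymm (fun u hu => ?_) (iSup₂_le fun t ht x hx => ?_)
  · -- `u - 𝟙_J(B) u` lies in `V` and in the kernel of `B`, where `P` vanishes
    have h1 : specProj B J u ∈ V := by
      have h2 : specProj B J u = B (partialInverse B J 0 u) := by
        have h3 := sub_smul_mul_partialInverse (B := B) (J := J) (c := 0) (half_pos hγ)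
          (fun x hx => by rw [sub_zero]; exact hx.2.1.trans (le_abs_self x)) hB hJ
        rw [← h3]
        simp
      rw [h2]
      exact compressionOp_mem V L _
    have h2 : B (u - specProj B J u) = 0 := by
      have h4 : specProj B Jᶜ (u - specProj B J u) = u - specProj B J u := by
        rw [specProj_compl hB hJ]
        simp [specProj_specProj hJ]
      have h5 := norm_sub_smul_le hB hJ.compl (c := 0) (r := 0) le_rfl (fun s hs => ?_) h4
      · simpa using h5
      · by_contra hne
        have hs0 : s ≠ 0 := by
          rintro rfl
          simp at hne
        have h6 := hmin s hs.1 hs0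
        exact hs.2 ⟨by linarith, (spectrum_compressionOp_subset V L hs.1).2⟩
    have h3 : u - specProj B J u = 0 := by
      refine hinj _ (V.sub_mem hu h1) ?_
      have h4 := re_inner_compressionOp V L (V.sub_mem hu h1)
      rw [← hBdef, h2, inner_zero_left, Complex.zero_re] at h4
      simpa using h4.symm
    rw [sub_eq_zero.1 h3]
    exact specProj_apply_mem hB hJ (hfin.inter_of_left _) u
  · rw [mem_eigenspace_iff] at hx
    have ht0 : (t : ℂ) ≠ 0 := by exact_mod_cast ((half_pos hγ).trans_le ht.1).ne'
    have h1 := V.smul_mem (t : ℂ)⁻¹ (compressionOp_mem V L x)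
    rwa [← hBdef, hx, inv_smul_smul₀ ht0] at h1

/-- Strong convergence `Q n → E` gives `Q n P Q n → E P E` in norm, because `P` has finite rank. -/
theorem tendsto_norm_compressionOp_sub {V : Submodule ℂ H} [V.HasOrthogonalProjection]
    {W : ℕ → Submodule ℂ H} [∀ n, (W n).HasOrthogonalProjection] (L : Submodule ℂ H)
    [FiniteDimensional ℂ L]
    (hlim : ∀ x, Tendsto (fun n => (W n).starProjection x) atTop (𝓝 (V.starProjection x))) :
    Tendsto (fun n => ‖compressionOp (W n) L - compressionOp V L‖) atTop (𝓝 0) := by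
  have h1 : Tendsto (fun n => ‖((W n).starProjection - V.starProjection) * L.starProjection‖)
      atTop (𝓝 0) := by
    refine tendsto_norm_mul_starProjection L fun x _ => ?_
    simpa using (hlim x).sub_const (V.starProjection x)
  refine squeeze_zero (fun n => norm_nonneg _) (fun n => ?_)
    (by simpa using h1.add h1)
  set Q := (W n).starProjection
  set E := V.starProjection
  set P := L.starProjection
  have h2 : compressionOp (W n) L - compressionOp V L = (Q - E) * P * Q + E * (P * (Q - E)) := by
    simp only [compressionOp, Q, E, P]
    noncomm_ring
  have h3 : ‖P * (Q - E)‖ = ‖(Q - E) * P‖ := by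
    rw [← norm_star, star_mul, star_sub, (isSelfAdjoint_starProjection _).star_eq,
      (isSelfAdjoint_starProjection _).star_eq, (isSelfAdjoint_starProjection _).star_eq]
  have hQ : ‖Q‖ ≤ 1 := (W n).starProjection_norm_le
  have hE : ‖E‖ ≤ 1 := V.starProjection_norm_le
  rw [h2]
  refine (norm_add_le _ _).trans (add_le_add ?_ ?_)
  · exact (norm_mul_le _ _).trans (mul_le_of_le_one_right (norm_nonneg _) hQ)
  · refine (norm_mul_le _ _).trans ?_
    rw [h3]
    exact mul_le_of_le_one_left (norm_nonneg _) hE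

section Perturbation

variable {V W L : Submodule ℂ H} [FiniteDimensional ℂ V] [FiniteDimensional ℂ W]
  [L.HasOrthogonalProjection] {γ : ℝ} (hγ : 0 < γ)

include hγ

/-- Elements of the spectral subspace of `B' = Q' P Q'` are close to the range `V` of `E`: they have
the form `u = B' w` with `‖w‖ ≤ (2 / γ) ‖u‖`, and `B w ∈ V` for `B = E P E`. -/
theorem norm_sub_starProjection_le {u : H}
    (hu : u ∈ eigSum (compressionOp W L) (Set.Icc (γ / 2) 1)) :
    ‖u - V.starProjection u‖ ≤
      ‖compressionOp W L - compressionOp V L‖ * (γ / 2)⁻¹ * ‖u‖ := by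
  set B := compressionOp V L with hBdef
  set B' := compressionOp W L
  set J := Set.Icc (γ / 2) 1
  have hB' : IsSelfAdjoint B' := isSelfAdjoint_compressionOp W L
  have hfin : (spectrum ℝ B').Finite := finite_spectrum_compressionOp W L
  have hJ := splitsSpectrum_of_finite hfin J
  have hlow : ∀ x ∈ spectrum ℝ B' ∩ J, γ / 2 ≤ |x - 0| := fun x hx => by
    rw [sub_zero]; exact hx.2.1.trans (le_abs_self x)
  set w := partialInverse B' J 0 u
  have hw : ‖w‖ ≤ (γ / 2)⁻¹ * ‖u‖ :=
    (partialInverse B' J 0).le_of_opNorm_le (norm_partialInverse_le (half_pos hγ) hlow) u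
  have huw : u = B' w := by
    have h1 := congrArg (fun T : H →L[ℂ] H => T u)
      (sub_smul_mul_partialInverse (half_pos hγ) hlow hB' hJ)
    simp only [specProj_apply_of_mem hB' hJ (hfin.inter_of_left _) hu] at h1
    rw [← h1]
    simp [w]
  have h2 : u - V.starProjection u = (B' - B) w - V.starProjection ((B' - B) w) := by
    have h3 : V.starProjection (B w) = B w :=
      Submodule.starProjection_eq_self_iff.2 (compressionOp_mem V L w)
    rw [sub_apply, map_sub, h3, ← huw]
    abel
  have h3 : ‖(B' - B) w - V.starProjection ((B' - B) w)‖ ≤ ‖(B' - B) w‖ := by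
    rw [← Submodule.starProjection_orthogonal_val]
    exact Vᗮ.norm_starProjection_apply_le _
  rw [h2, mul_assoc]
  exact h3.trans (((B' - B).le_opNorm w).trans (by gcongr))

/-- The argument of the Davis–Kahan theorem: `X = (1 - G) E` satisfies
`X = (1 - G) (B - B') K + B' X K`, where `K` inverts `B` on the range of `E`, so that `‖K‖ ≤ 1 / γ`,
and `B'` is bounded by `γ / 2` on the range of `1 - G`. -/
theorem norm_sub_specProj_le (hinj : ∀ u ∈ V, L.starProjection u = 0 → u = 0)
    (hmin : ∀ s ∈ spectrum ℝ (compressionOp V L), s ≠ 0 → γ ≤ s) {v : H} (hv : v ∈ V) :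
    ‖v - specProj (compressionOp W L) (Set.Icc (γ / 2) 1) v‖ ≤
      ‖compressionOp W L - compressionOp V L‖ * (γ / 2)⁻¹ * ‖v‖ := by
  have hE := specProj_compressionOp_eq hinj hγ hmin
  set B := compressionOp V L with hBdef
  set B' := compressionOp W L
  set J := Set.Icc (γ / 2) 1
  have hB : IsSelfAdjoint B := isSelfAdjoint_compressionOp V L
  have hJB := splitsSpectrum_of_finite (finite_spectrum_compressionOp V L) J
  have hB' : IsSelfAdjoint B' := isSelfAdjoint_compressionOp W L
  have hfin : (spectrum ℝ B').Finite := finite_spectrum_compressionOp W L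
  have hJ := splitsSpectrum_of_finite hfin J
  have hlow : ∀ x ∈ spectrum ℝ B ∩ J, γ ≤ |x - 0| := fun x hx => by
    have hx0 : x ≠ 0 := ((half_pos hγ).trans_le hx.2.1).ne'
    rw [sub_zero]
    exact (hmin x hx.1 hx0).trans (le_abs_self x)
  set K := partialInverse B J 0
  have hK : ‖K‖ ≤ γ⁻¹ := norm_partialInverse_le hγ hlow
  have hBK : B * K = V.starProjection := by
    have := sub_smul_mul_partialInverse hγ hlow hB hJB
    simpa [hE] using this
  have hEK : V.starProjection * K = K := by
    have := specProj_mul_partialInverse hγ hlow hJB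
    rwa [hE] at this
  set F := specProj B' Jᶜ with hF
  have hF1 : ‖F‖ ≤ 1 := norm_cutoff_le zero_le_one fun s _ => by simp
  set X := F * V.starProjection with hX
  have hFB : ∀ x, F (B' x) = B' (F x) := fun x => by
    simpa using specProj_apply_sub_smul hB' hJ.compl 0 x
  have hXK : ‖X‖ ≤ ‖B' - B‖ * γ⁻¹ + γ / 2 * (‖X‖ * γ⁻¹) := by
    refine ContinuousLinearMap.opNorm_le_bound _ (by positivity) fun x => ?_
    have h1 : X x = B' (X (K x)) - F ((B' - B) (K x)) := by
      have h2 : V.starProjection (K x) = K x := congrArg (fun T : H →L[ℂ] H => T x) hEK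
      have h3 : V.starProjection x = B (K x) := (congrArg (fun T : H →L[ℂ] H => T x) hBK).symm
      show F (V.starProjection x) = B' (F (V.starProjection (K x))) - F (B' (K x) - B (K x))
      rw [h2, h3, map_sub, hFB]
      abel
    have hKx : ‖K x‖ ≤ γ⁻¹ * ‖x‖ := K.le_of_opNorm_le hK x
    have h4 : ‖B' (X (K x))‖ ≤ γ / 2 * (‖X‖ * (γ⁻¹ * ‖x‖)) := by
      have h5 := norm_sub_smul_le hB' hJ.compl (c := 0) (r := γ / 2) (by positivity)
        (fun s hs => ?_) (specProj_specProj hJ.compl (V.starProjection (K x)))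
      · rw [Complex.ofReal_zero, zero_smul, sub_zero] at h5
        refine h5.trans ?_
        gcongr
        exact (X.le_opNorm (K x)).trans (by gcongr)
      · obtain ⟨h6, h7⟩ := spectrum_compressionOp_subset W L hs.1
        rw [sub_zero, abs_of_nonneg h6]
        by_contra! h8
        exact hs.2 ⟨h8.le, h7⟩
    have h5 : ‖F ((B' - B) (K x))‖ ≤ ‖B' - B‖ * (γ⁻¹ * ‖x‖) :=
      (F.le_of_opNorm_le hF1 _).trans
        (by rw [one_mul]; exact ((B' - B).le_opNorm _).trans (by gcongr))
    rw [h1]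
    refine (norm_sub_le _ _).trans ((add_le_add h4 h5).trans (le_of_eq ?_))
    ring
  have hXle : ‖X‖ ≤ ‖B' - B‖ * (γ / 2)⁻¹ := by
    have h1 : γ / 2 * (‖X‖ * γ⁻¹) = ‖X‖ / 2 := by field_simp
    have h2 : (γ / 2)⁻¹ = 2 * γ⁻¹ := by rw [inv_div]; ring
    rw [h1] at hXK
    rw [h2]
    linarith
  have h1 : v - specProj B' J v = X v := by
    show _ = F (V.starProjection v)
    rw [Submodule.starProjection_eq_self_iff.2 hv, hF, specProj_compl hB' hJ]
    rfl
  rw [h1]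
  exact X.le_of_opNorm_le hXle v

end Perturbation

end Compression

/-! ### Convergence in the form norm -/

section FormConvergence

variable {H : Type*} [NormedAddCommGroup H] [InnerProductSpace ℂ H]

/-- With `T = (A - κ)^{-1/2}`, so that the form norm of `T x` is `‖x‖`, this says that every `u` in
`T X` has an element of `T Y` within distance `ε ‖u‖` in the form norm. As `‖u‖ ≤ ‖u‖_𝔞`, it bounds
the one-sided gaps in both norms. -/
def RelClose (T : H →L[ℂ] H) (X Y : Submodule ℂ H) (ε : ℝ) : Prop :=
  ∀ x ∈ X, ∃ y ∈ Y, ‖x - y‖ ≤ ε * ‖T x‖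

theorem tendsto_ritzOp_apply {T : H →L[ℂ] H} {X : ℕ → Submodule ℂ H}
    [∀ n, (X n).HasOrthogonalProjection]
    (hX : ∀ x, Tendsto (fun n => (X n).starProjection x) atTop (𝓝 x)) (x : H) :
    Tendsto (fun n => ritzOp T (X n) x) atTop (𝓝 ((T * T) x)) :=
  (T.continuous.tendsto _).comp (hX (T x))

theorem finite_spectrum_ritzOp (T : H →L[ℂ] H) (X : Submodule ℂ H) [FiniteDimensional ℂ X] :
    (spectrum ℝ (ritzOp T X)).Finite :=
  finite_spectrum_of_range_le (X.map (T : H →ₗ[ℂ] H)) fun x =>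
    ⟨X.starProjection (T x), Submodule.starProjection_apply_mem _ _, rfl⟩

variable [CompleteSpace H]

/-- A lift of the spectral projection of `S = T P T` through `T`: it satisfies `T Z = 𝟙_J(S)`. -/
def specLift (T P S : H →L[ℂ] H) (J : Set ℝ) : H →L[ℂ] H := P * T * partialInverse S J 0

section specLift

variable {T P S : H →L[ℂ] H} {J : Set ℝ} {α : ℝ}

theorem norm_specLift_le (hT : ‖T‖ ≤ 1) (hP : ‖P‖ ≤ 1) (hα : 0 < α) (hJ : ∀ s ∈ J, α ≤ s) :
    ‖specLift T P S J‖ ≤ α⁻¹ := by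
  have h1 : ‖partialInverse S J 0‖ ≤ α⁻¹ := norm_partialInverse_le hα fun s hs => by
    rw [sub_zero]; exact (hJ s hs.2).trans (le_abs_self s)
  calc ‖specLift T P S J‖ ≤ ‖P‖ * ‖T‖ * ‖partialInverse S J 0‖ :=
        (norm_mul_le _ _).trans (by gcongr; exact norm_mul_le _ _)
    _ ≤ 1 * 1 * α⁻¹ := by gcongr
    _ = α⁻¹ := by ring

theorem mul_specLift (hS : S = T * P * T) (hSsa : IsSelfAdjoint S) (hα : 0 < α)
    (hJ : ∀ s ∈ J, α ≤ s) (hsplit : SplitsSpectrum S J) :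
    T * specLift T P S J = specProj S J := by
  rw [← sub_smul_mul_partialInverse (c := 0) hα
    (fun s hs => by rw [sub_zero]; exact (hJ s hs.2).trans (le_abs_self s)) hSsa hsplit]
  nth_rewrite 2 [hS]
  rw [specLift, Complex.ofReal_zero, zero_smul, sub_zero]
  simp only [mul_assoc]

/-- On `𝟙_J(S)` with `J ⊆ [α, ∞)`, the form norm is bounded by the norm of `H`. -/
theorem norm_le_of_apply_mem_eigSum (hTn : ‖T‖ ≤ 1) (hTinj : Function.Injective T) (hP : ‖P‖ ≤ 1)
    (hS : S = T * P * T) (hSsa : IsSelfAdjoint S) (hα : 0 < α) (hJ : ∀ s ∈ J, α ≤ s)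
    (hsplit : SplitsSpectrum S J) (hfin : (spectrum ℝ S ∩ J).Finite) {x : H}
    (hx : T x ∈ eigSum S J) : x = specLift T P S J (T x) ∧ ‖x‖ ≤ α⁻¹ * ‖T x‖ := by
  have h1 : x = specLift T P S J (T x) := by
    refine hTinj ?_
    have h2 := congrArg (fun D : H →L[ℂ] H => D (T x)) (mul_specLift hS hSsa hα hJ hsplit)
    simp only [specProj_apply_of_mem hSsa hsplit hfin hx] at h2
    exact h2.symm
  refine ⟨h1, ?_⟩
  conv_lhs => rw [h1]
  exact (specLift T P S J).le_of_opNorm_le (norm_specLift_le hTn hP hα hJ) _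

end specLift

section Convergence

variable {T : H →L[ℂ] H} (hTsa : IsSelfAdjoint T) {X : ℕ → Submodule ℂ H}
  [∀ n, FiniteDimensional ℂ (X n)]
  (hX : ∀ x, Tendsto (fun n => (X n).starProjection x) atTop (𝓝 x)) {α β : ℝ} (hα : 0 < α)
  (hI : ∀ s ∈ spectrum ℝ (T * T) ∩ Set.Icc α β, s ∈ Set.Ioo α β)
  (hsplit : SplitsSpectrum (T * T) (Set.Icc α β))
  (hfin : (spectrum ℝ (T * T) ∩ Set.Icc α β).Finite)

include hTsa hX hα hI hsplit hfin

/-- The lifts of the spectral projections of the Galerkin resolvents converge strongly, so that the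
spectral projections converge in the form norm on the spectral subspace. -/
theorem tendsto_specLift_apply (f : H) :
    Tendsto (fun n => specLift T (X n).starProjection (ritzOp T (X n)) (Set.Icc α β)
      (specProj (T * T) (Set.Icc α β) f)) atTop (𝓝 (specLift T 1 (T * T) (Set.Icc α β) f)) := by
  set J := Set.Icc α β with hJdef
  have hR : IsSelfAdjoint (T * T) := by rw [IsSelfAdjoint, star_mul, hTsa.star_eq]
  have hS : ∀ n, IsSelfAdjoint (ritzOp T (X n)) := fun n => isSelfAdjoint_ritzOp hTsa _
  have hSfin : ∀ n, (spectrum ℝ (ritzOp T (X n))).Finite := fun n => finite_spectrum_ritzOp T _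
  have hSJ : ∀ n, SplitsSpectrum (ritzOp T (X n)) J := fun n => splitsSpectrum_of_finite (hSfin n) J
  have hlow : ∀ (S : H →L[ℂ] H), ∀ s ∈ spectrum ℝ S ∩ J, α ≤ |s - 0| := fun S s hs => by
    rw [sub_zero]; exact hs.2.1.trans (le_abs_self s)
  set K := partialInverse (T * T) J 0 with hK
  set g := K f with hg
  have hRg : (T * T) g = specProj (T * T) J f := by
    have := congrArg (fun D : H →L[ℂ] H => D f)
      (sub_smul_mul_partialInverse hα (hlow _) hR hsplit)
    simpa using this
  have hEg : specProj (T * T) J g = g :=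
    congrArg (fun D : H →L[ℂ] H => D f) (specProj_mul_partialInverse hα (hlow _) hsplit)
  -- `K n (R g) = Q n g + K n ((R - S n) g)` converges to `g`
  have h1 : Tendsto (fun n => partialInverse (ritzOp T (X n)) J 0 (specProj (T * T) J f)) atTop
      (𝓝 g) := by
    have h2 := tendsto_specProj_apply hR hS (tendsto_ritzOp_apply hX) hI hsplit hfin hSfin g
    rw [← hJdef, hEg] at h2
    have h3 : Tendsto (fun n => partialInverse (ritzOp T (X n)) J 0
        ((T * T) g - ritzOp T (X n) g)) atTop (𝓝 0) := by
      refine squeeze_zero_norm (a := fun n => α⁻¹ * ‖(T * T) g - ritzOp T (X n) g‖)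
        (fun n => ContinuousLinearMap.le_of_opNorm_le _ (norm_partialInverse_le hα (hlow _)) _) ?_
      have h4 := ((tendsto_const_nhds (x := (T * T) g)).sub
        (tendsto_ritzOp_apply (T := T) hX g)).norm.const_mul α⁻¹
      simpa using h4
    have h4 := h2.add h3
    rw [add_zero] at h4
    refine h4.congr fun n => ?_
    have h5 : specProj (ritzOp T (X n)) J g =
        partialInverse (ritzOp T (X n)) J 0 (ritzOp T (X n) g) := by
      have := congrArg (fun D : H →L[ℂ] H => D g)
        (partialInverse_mul_sub_smul hα (hlow _) (hS n) (hSJ n))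
      simpa using this.symm
    rw [h5, ← map_add, add_sub_cancel, hRg]
  have h2 : Tendsto (fun n => (X n).starProjection
      (T (partialInverse (ritzOp T (X n)) J 0 (specProj (T * T) J f)) - T g)) atTop (𝓝 0) := by
    have h3 : Tendsto (fun n => T (partialInverse (ritzOp T (X n)) J 0 (specProj (T * T) J f))
        - T g) atTop (𝓝 0) := by
      simpa using ((T.continuous.tendsto _).comp h1).sub_const (T g)
    exact squeeze_zero_norm (fun n => (X n).norm_starProjection_apply_le _) (by simpa using h3.norm)
  have h3 := h2.add (hX (T g))
  simp only [map_sub, sub_add_cancel, zero_add] at h3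
  exact h3

/-- The spectral subspaces `M n` of the compressions `Q n P Q n` converge to `V` in the form norm.
For `u ∈ M n` the lifts of `u` and `E u` differ by `Z n (u - E u) + (Z n E - Z) u`, where the first
term is small by perturbation theory in the norm of `H`; the other direction is analogous. -/
theorem eventually_relClose {V : Submodule ℂ H} [FiniteDimensional ℂ V]
    (hTn : ‖T‖ ≤ 1) (hTinj : Function.Injective T) (hV : V = eigSum (T * T) (Set.Icc α β))
    {W : ℕ → Submodule ℂ H} [∀ n, FiniteDimensional ℂ (W n)]
    (hW : ∀ n, W n = eigSum (ritzOp T (X n)) (Set.Icc α β))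
    (L : Submodule ℂ H) [FiniteDimensional ℂ L]
    (hinj : ∀ u ∈ V, L.starProjection u = 0 → u = 0) {γ : ℝ} (hγ : 0 < γ)
    (hmin : ∀ s ∈ spectrum ℝ (compressionOp V L), s ≠ 0 → γ ≤ s) {ε : ℝ} (hε : 0 < ε) :
    ∀ᶠ n in atTop,
      RelClose T ((eigSum (compressionOp (W n) L) (Set.Icc (γ / 2) 1)).comap (T : H →ₗ[ℂ] H))
        (V.comap (T : H →ₗ[ℂ] H)) ε ∧
      RelClose T (V.comap (T : H →ₗ[ℂ] H))
        ((eigSum (compressionOp (W n) L) (Set.Icc (γ / 2) 1)).comap (T : H →ₗ[ℂ] H)) ε := by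
  set J := Set.Icc α β with hJdef
  have hR : IsSelfAdjoint (T * T) := by rw [IsSelfAdjoint, star_mul, hTsa.star_eq]
  have hS : ∀ n, IsSelfAdjoint (ritzOp T (X n)) := fun n => isSelfAdjoint_ritzOp hTsa _
  have hSfin : ∀ n, (spectrum ℝ (ritzOp T (X n))).Finite := fun n => finite_spectrum_ritzOp T _
  have hSJ : ∀ n, SplitsSpectrum (ritzOp T (X n)) J := fun n => splitsSpectrum_of_finite (hSfin n) J
  have hJα : ∀ s ∈ J, α ≤ s := fun s hs => hs.1
  have hE : V.starProjection = specProj (T * T) J := starProjection_eq_specProj hR hsplit hfin V hV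
  have hQ : ∀ n, (W n).starProjection = specProj (ritzOp T (X n)) J := fun n =>
    starProjection_eq_specProj (hS n) (hSJ n) ((hSfin n).inter_of_left _) (W n) (hW n)
  set Z := specLift T 1 (T * T) J with hZ
  have hTZ : T * Z = specProj (T * T) J := mul_specLift (by rw [mul_one]) hR hα hJα hsplit
  set Zn : ℕ → H →L[ℂ] H := fun n => specLift T (X n).starProjection (ritzOp T (X n)) J with hZn
  have hTZn : ∀ n, T * Zn n = specProj (ritzOp T (X n)) J := fun n =>
    mul_specLift rfl (hS n) hα hJα (hSJ n)
  have hZnle : ∀ n, ‖Zn n‖ ≤ α⁻¹ := fun n =>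
    norm_specLift_le hTn (X n).starProjection_norm_le hα hJα
  have hZE : Z * V.starProjection = Z := by
    rw [hE, hZ, specLift, mul_assoc, partialInverse_mul_specProj hα (fun s hs => ?_) hsplit]
    rw [sub_zero]; exact hs.2.1.trans (le_abs_self s)
  -- `Z n E → Z` in norm
  have hη : Tendsto (fun n => ‖Zn n * V.starProjection - Z‖) atTop (𝓝 0) := by
    have h1 := tendsto_norm_mul_starProjection (D := fun n => Zn n * V.starProjection - Z) V
      fun x _ => by
        have h2 := (tendsto_specLift_apply hTsa hX hα hI hsplit hfin x).sub_const (Z x)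
        rw [← hJdef, ← hZ, sub_self, ← hE] at h2
        exact h2
    refine h1.congr fun n => ?_
    rw [sub_mul, hZE, mul_assoc, V.isIdempotentElem_starProjection.eq]
  have hB : Tendsto (fun n => ‖compressionOp (W n) L - compressionOp V L‖) atTop (𝓝 0) := by
    refine tendsto_norm_compressionOp_sub L fun x => ?_
    simp only [hQ, hE]
    exact tendsto_specProj_apply hR hS (tendsto_ritzOp_apply hX) hI hsplit hfin hSfin x
  have hsum := ((hB.mul_const (γ / 2)⁻¹).const_mul α⁻¹).add hη
  simp only [zero_mul, mul_zero, add_zero] at hsum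
  filter_upwards [hsum.eventually_le_const hε] with n hn
  set ρ := ‖compressionOp (W n) L - compressionOp V L‖ * (γ / 2)⁻¹
  set G := specProj (compressionOp (W n) L) (Set.Icc (γ / 2) 1)
  have hGmem : ∀ x, G x ∈ eigSum (compressionOp (W n) L) (Set.Icc (γ / 2) 1) :=
    specProj_apply_mem (isSelfAdjoint_compressionOp _ _)
      (splitsSpectrum_of_finite (finite_spectrum_compressionOp _ _) _)
      ((finite_spectrum_compressionOp _ _).inter_of_left _)
  have hMW : eigSum (compressionOp (W n) L) (Set.Icc (γ / 2) 1) ≤ W n := by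
    refine iSup₂_le fun t ht x hx => ?_
    rw [mem_eigenspace_iff] at hx
    have ht0 : (t : ℂ) ≠ 0 := by exact_mod_cast ((half_pos hγ).trans_le ht.1).ne'
    have h1 := (W n).smul_mem (t : ℂ)⁻¹ (compressionOp_mem (W n) L x)
    rwa [hx, inv_smul_smul₀ ht0] at h1
  have hlift : ∀ u ∈ W n, T (Zn n u) = u := fun u hu => by
    have h1 := congrArg (fun D : H →L[ℂ] H => D u) (hTZn n)
    rw [← hQ n] at h1
    exact h1.trans (Submodule.starProjection_eq_self_iff.2 hu)
  have hliftE : ∀ u, T (Z u) = V.starProjection u := fun u => by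
    rw [hE, ← hTZ]
    rfl
  have hbound : ∀ u w : H, ‖w‖ ≤ ρ * ‖u‖ →
      ‖Zn n w‖ + ‖(Zn n * V.starProjection - Z) u‖ ≤ ε * ‖u‖ := by
    intro u w hw
    have h1 : ‖Zn n w‖ ≤ α⁻¹ * (ρ * ‖u‖) :=
      ((Zn n).le_of_opNorm_le (hZnle n) w).trans (by gcongr)
    have h2 := (Zn n * V.starProjection - Z).le_opNorm u
    nlinarith [mul_le_mul_of_nonneg_right hn (norm_nonneg u)]
  refine ⟨fun x hx => ?_, fun x hx => ?_⟩
  · have hu : T x ∈ eigSum (compressionOp (W n) L) (Set.Icc (γ / 2) 1) := hx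
    have hxu : x = Zn n (T x) := hTinj (hlift _ (hMW hu)).symm
    refine ⟨Z (T x), ?_, ?_⟩
    · show T (Z (T x)) ∈ V
      rw [hliftE]
      exact Submodule.starProjection_apply_mem _ _
    · have h1 : x - Z (T x) = Zn n (T x - V.starProjection (T x)) +
          (Zn n * V.starProjection - Z) (T x) := by
        rw [map_sub, ← hxu, sub_apply, mul_apply_eq_comp]
        abel
      rw [h1]
      exact (norm_add_le _ _).trans (hbound _ _ (norm_sub_starProjection_le hγ hu))
  · have hv : T x ∈ V := hx
    have hxv : x = Z (T x) := by
      refine hTinj ?_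
      rw [hliftE, Submodule.starProjection_eq_self_iff.2 hv]
    refine ⟨Zn n (G (T x)), ?_, ?_⟩
    · show T (Zn n (G (T x))) ∈ eigSum (compressionOp (W n) L) (Set.Icc (γ / 2) 1)
      rw [hlift _ (hMW (hGmem _))]
      exact hGmem _
    · have h1 : x - Zn n (G (T x)) = Zn n (T x - G (T x)) -
          (Zn n * V.starProjection - Z) (T x) := by
        rw [map_sub, sub_apply, mul_apply_eq_comp, Submodule.starProjection_eq_self_iff.2 hv, ← hxv]
        abel
      rw [h1]
      exact (norm_sub_le _ _).trans (hbound _ _ (norm_sub_specProj_le hγ hinj hmin hv))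

end Convergence

end FormConvergence

/-! ### Gaps -/

section GapBounds

variable {E : Type*} [AddCommGroup E] [Module ℂ E] {N : E → ℝ} (hN : ∀ u, 0 ≤ N u)

include hN

theorem gap_nonneg (L M : Submodule ℂ E) : 0 ≤ gap N L M := by
  refine Real.sSup_nonneg ?_
  rintro _ ⟨u, -, -, rfl⟩
  exact Real.iInf_nonneg fun v => hN _

theorem gap_le {L M : Submodule ℂ E} {ε : ℝ} (hε : 0 ≤ ε)
    (h : ∀ u ∈ L, N u = 1 → ∃ v ∈ M, N (u - v) ≤ ε) : gap N L M ≤ ε := by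
  refine Real.sSup_le ?_ hε
  rintro _ ⟨u, hu, hu1, rfl⟩
  obtain ⟨v, hv, hle⟩ := h u hu hu1
  refine (ciInf_le ⟨0, ?_⟩ (⟨v, hv⟩ : M)).trans hle
  rintro _ ⟨v, rfl⟩
  exact hN _

theorem symGap_nonneg (L M : Submodule ℂ E) : 0 ≤ symGap N L M :=
  (gap_nonneg hN L M).trans (le_max_left _ _)

end GapBounds

section Hilbert

variable {H : Type*} [NormedAddCommGroup H] [InnerProductSpace ℂ H]

/-- If the gap from `V` to `L` is less than `1`, then no nonzero vector of `V` is orthogonal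
to `L`. -/
theorem eq_zero_of_gap_lt_one {V L : Submodule ℂ H} [L.HasOrthogonalProjection]
    (h : gap (fun u : H => ‖u‖) V L < 1) {u : H} (hu : u ∈ V) (hPu : L.starProjection u = 0) :
    u = 0 := by
  by_contra hu0
  refine absurd h (not_lt.2 ?_)
  set w : H := ((‖u‖⁻¹ : ℝ) : ℂ) • u with hw
  have hw1 : ‖w‖ = 1 := by
    rw [hw, norm_smul, Complex.norm_real, norm_inv, norm_norm,
      inv_mul_cancel₀ (norm_ne_zero_iff.2 hu0)]
  have hwL : ∀ v ∈ L, ⟪w, v⟫ = 0 := by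
    intro v hv
    rw [hw, inner_smul_left, ← Submodule.starProjection_eq_self_iff.2 hv,
      ← Submodule.inner_starProjection_left_eq_right, hPu, inner_zero_left, mul_zero]
  have hge : ∀ v : L, 1 ≤ ‖w - (v : H)‖ := by
    intro v
    have h1 := norm_sub_sq (𝕜 := ℂ) w v
    rw [hwL v v.2, hw1] at h1
    simp only [map_zero, mul_zero, sub_zero, one_pow] at h1
    nlinarith [sq_nonneg ‖(v : H)‖, norm_nonneg (w - (v : H))]
  have hbdd : BddAbove {r : ℝ | ∃ u ∈ V, ‖u‖ = 1 ∧ r = ⨅ v : L, ‖u - (v : H)‖} := by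
    refine ⟨1, ?_⟩
    rintro _ ⟨u, -, hu1, rfl⟩
    refine (ciInf_le ⟨0, ?_⟩ (0 : L)).trans (by simp [hu1])
    rintro _ ⟨v, rfl⟩
    exact norm_nonneg _
  exact (le_ciInf hge).trans (le_csSup hbdd ⟨w, V.smul_mem _ hu, hw1, rfl⟩)

theorem tendsto_starProjection_of_exists_tendsto {X : ℕ → Submodule ℂ H}
    [∀ n, (X n).HasOrthogonalProjection] {x : H}
    (h : ∃ y : ℕ → H, (∀ n, y n ∈ X n) ∧ Tendsto (fun n => ‖x - y n‖) atTop (𝓝 0)) :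
    Tendsto (fun n => (X n).starProjection x) atTop (𝓝 x) := by
  obtain ⟨y, hy, hlim⟩ := h
  have h1 : Tendsto (fun n => x - (X n).starProjection x) atTop (𝓝 0) := by
    refine squeeze_zero_norm (fun n => ?_) hlim
    have h2 : x - (X n).starProjection x = (X n)ᗮ.starProjection (x - y n) := by
      rw [Submodule.starProjection_orthogonal_val, map_sub,
        Submodule.starProjection_eq_self_iff.2 (hy n)]
      abel
    rw [h2]
    exact (X n)ᗮ.norm_starProjection_apply_le _
  have h3 := (tendsto_const_nhds (x := x)).sub h1
  simpa only [sub_sub_cancel, sub_zero] using h3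

variable [CompleteSpace H]

/-- Relatively close spaces have close Galerkin resolvents. -/
theorem norm_ritzOp_sub_le {T : H →L[ℂ] H} (hT : ‖T‖ ≤ 1) {X Y : Submodule ℂ H}
    [X.HasOrthogonalProjection] [Y.HasOrthogonalProjection] {ε : ℝ} (hε : 0 ≤ ε)
    (hXY : RelClose T X Y ε) (hYX : RelClose T Y X ε) :
    ‖ritzOp T X - ritzOp T Y‖ ≤ 2 * ε := by
  have key : ∀ (X Y : Submodule ℂ H) [X.HasOrthogonalProjection] [Y.HasOrthogonalProjection],
      RelClose T X Y ε → ‖(1 - Y.starProjection) * X.starProjection‖ ≤ ε := by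
    intro X Y _ _ h
    refine ContinuousLinearMap.opNorm_le_bound _ hε fun x => ?_
    set z := X.starProjection x with hz
    obtain ⟨y, hy, hle⟩ := h z (Submodule.starProjection_apply_mem _ _)
    have h1 : ((1 - Y.starProjection) * X.starProjection) x = Yᗮ.starProjection (z - y) := by
      rw [Submodule.starProjection_orthogonal_val, map_sub,
        Submodule.starProjection_eq_self_iff.2 hy]
      show z - Y.starProjection z = _
      abel
    have h2 : ‖T z‖ ≤ ‖z‖ := by simpa using T.le_of_opNorm_le hT z
    rw [h1]
    refine (Yᗮ.norm_starProjection_apply_le _).trans (hle.trans ?_)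
    gcongr
    exact h2.trans (X.norm_starProjection_apply_le x)
  have h1 := key X Y hXY
  have h2 : ‖Y.starProjection * (1 - X.starProjection)‖ ≤ ε := by
    have h3 := key Y X hYX
    rwa [← norm_star, star_mul, star_sub, star_one, (isSelfAdjoint_starProjection _).star_eq,
      (isSelfAdjoint_starProjection _).star_eq] at h3
  have h3 : ritzOp T X - ritzOp T Y = T * ((1 - Y.starProjection) * X.starProjection -
      Y.starProjection * (1 - X.starProjection)) * T := by
    simp only [ritzOp]
    noncomm_ring
  rw [h3]
  calc _ ≤ ‖T‖ * ‖(1 - Y.starProjection) * X.starProjection -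
        Y.starProjection * (1 - X.starProjection)‖ * ‖T‖ :=
        (norm_mul_le _ _).trans (by gcongr; exact norm_mul_le _ _)
    _ ≤ 1 * (ε + ε) * 1 := by
        gcongr
        exact (norm_sub_le _ _).trans (add_le_add h1 h2)
    _ = 2 * ε := by ring

theorem formNorm_nonneg (A : H →ₗ.[ℂ] H) (u : formDomain A) : 0 ≤ formNorm A u :=
  Real.sqrt_nonneg _

namespace FormRoot

variable {A : H →ₗ.[ℂ] H} {κ : ℝ} {T : H →L[ℂ] H} (hT : FormRoot A κ T)

include hT

theorem gap_le_of_relClose {U V : Submodule ℂ H} (hU : U ≤ formDomain A) {ε : ℝ} (hε : 0 ≤ ε)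
    (h : RelClose T (U.comap (T : H →ₗ[ℂ] H)) (V.comap (T : H →ₗ[ℂ] H)) ε) :
    gap (fun u : H => ‖u‖) U V ≤ ε := by
  refine gap_le (fun _ => norm_nonneg _) hε fun u hu hu1 => ?_
  obtain ⟨x, rfl⟩ := (hT.mem_formDomain u).1 (hU hu)
  obtain ⟨y, hy, hle⟩ := h x hu
  refine ⟨T y, hy, ?_⟩
  rw [hu1, mul_one] at hle
  show ‖T x - T y‖ ≤ ε
  rw [← map_sub]
  exact (hT.norm_apply_le _).trans hle

theorem gap_formNorm_le_of_relClose {U V : Submodule ℂ H} {ε : ℝ} (hε : 0 ≤ ε)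
    (h : RelClose T (U.comap (T : H →ₗ[ℂ] H)) (V.comap (T : H →ₗ[ℂ] H)) ε) :
    gap (formNorm A) (U.submoduleOf (formDomain A)) (V.submoduleOf (formDomain A)) ≤ ε := by
  refine gap_le (formNorm_nonneg A) hε ?_
  rintro ⟨u, hu⟩ huU hu1
  obtain ⟨x, rfl⟩ := (hT.mem_formDomain u).1 hu
  rw [hT.formNorm_apply] at hu1
  obtain ⟨y, hy, hle⟩ := h x huU
  refine ⟨⟨T y, hT.apply_mem y⟩, hy, ?_⟩
  have h1 : (⟨T x, hu⟩ : formDomain A) - ⟨T y, hT.apply_mem y⟩ =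
      ⟨T (x - y), hT.apply_mem _⟩ := Subtype.ext (map_sub T x y).symm
  rw [h1, hT.formNorm_apply]
  refine hle.trans (mul_le_of_le_one_right hε ?_)
  rw [← hu1]
  exact hT.norm_apply_le x

theorem symGap_le_of_relClose {U V : Submodule ℂ H} (hU : U ≤ formDomain A)
    (hV : V ≤ formDomain A) {ε : ℝ} (hε : 0 ≤ ε)
    (h : RelClose T (U.comap (T : H →ₗ[ℂ] H)) (V.comap (T : H →ₗ[ℂ] H)) ε)
    (h' : RelClose T (V.comap (T : H →ₗ[ℂ] H)) (U.comap (T : H →ₗ[ℂ] H)) ε) :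
    symGap (fun u : H => ‖u‖) U V ≤ ε ∧ symGapForm A U V ≤ ε :=
  ⟨max_le (hT.gap_le_of_relClose hU hε h) (hT.gap_le_of_relClose hV hε h'),
    max_le (hT.gap_formNorm_le_of_relClose hε h) (hT.gap_formNorm_le_of_relClose hε h')⟩

/-! ### Galerkin eigenvalues -/

theorem mem_galerkinSpec_iff {W X : Submodule ℂ H} [X.HasOrthogonalProjection]
    (hX : X.map (T : H →ₗ[ℂ] H) = W) {μ : ℝ} :
    μ ∈ galerkinSpec A W ↔
      κ + 1 ≤ μ ∧ ∃ u, u ≠ 0 ∧ ritzOp T X u = (((μ - κ)⁻¹ : ℝ) : ℂ) • u := by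
  constructor
  · intro h
    have h1 : κ + 1 ≤ μ := not_lt.1 fun hlt => h (hT.galerkinEigSpace_eq_bot hX hlt)
    rw [galerkinSpec, Set.mem_ofPred_eq, hT.galerkinEigSpace_eq hX (by linarith)] at h
    obtain ⟨u, hu, hu0⟩ := Submodule.exists_mem_ne_zero_of_ne_bot h
    exact ⟨h1, u, hu0, mem_eigenspace_iff.1 hu⟩
  · rintro ⟨h1, u, hu0, hu⟩ hbot
    rw [hT.galerkinEigSpace_eq hX (by linarith), Submodule.eq_bot_iff] at hbot
    exact hu0 (hbot u (mem_eigenspace_iff.2 hu))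

theorem norm_ritzOp_le (X : Submodule ℂ H) [X.HasOrthogonalProjection] : ‖ritzOp T X‖ ≤ 1 := by
  have h1 := hT.norm_le_one
  have h2 := X.starProjection_norm_le
  calc ‖ritzOp T X‖ ≤ ‖T‖ * ‖X.starProjection‖ * ‖T‖ :=
        (norm_mul_le _ _).trans (by gcongr; exact norm_mul_le _ _)
    _ ≤ 1 * 1 * 1 := by gcongr
    _ = 1 := by norm_num

/-- Each Galerkin eigenvalue for `U` is close to one for `W` if the trial spaces are relatively
close and the form norm is bounded by `C ‖·‖` on `U`, which bounds the Galerkin eigenvalues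
for `U`. -/
theorem exists_mem_galerkinSpec {U W : Submodule ℂ H} [FiniteDimensional ℂ U]
    [FiniteDimensional ℂ W] (hU : U ≤ formDomain A) (hW : W ≤ formDomain A) {C ε : ℝ} (hC : 0 < C)
    (hbound : ∀ x, T x ∈ U → ‖x‖ ≤ C * ‖T x‖) (hε : 0 < ε) (hεC : 6 * ε * C ^ 2 ≤ 1)
    (h : RelClose T (U.comap (T : H →ₗ[ℂ] H)) (W.comap (T : H →ₗ[ℂ] H)) ε)
    (h' : RelClose T (W.comap (T : H →ₗ[ℂ] H)) (U.comap (T : H →ₗ[ℂ] H)) ε)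
    {μ : ℝ} (hμ : μ ∈ galerkinSpec A U) :
    ∃ ν ∈ galerkinSpec A W, |μ - ν| ≤ 6 * C ^ 4 * ε := by
  have := hT.finiteDimensional_comap U
  have := hT.finiteDimensional_comap W
  have hXU := hT.map_comap hU
  have hXW := hT.map_comap hW
  set X := U.comap (T : H →ₗ[ℂ] H)
  set Y := W.comap (T : H →ₗ[ℂ] H)
  have hclose := norm_ritzOp_sub_le hT.norm_le_one hε.le h h'
  obtain ⟨hμ1, u, hu0, hu⟩ := (hT.mem_galerkinSpec_iff hXU).1 hμ
  set s := (μ - κ)⁻¹ with hs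
  have hs0 : 0 < s := inv_pos.2 (by linarith)
  -- `s ‖x‖² = ‖T x‖²` for the lift `x` of an eigenvector
  have hsC : 1 ≤ s * C ^ 2 := by
    obtain ⟨v, hv, hv0⟩ := Submodule.exists_mem_ne_zero_of_ne_bot hμ
    obtain ⟨x, hx, rfl, hform⟩ := (hT.mem_galerkinEigSpace hXU).1 hv
    have h1 := congrArg Complex.re (hform x hx)
    rw [Complex.re_ofReal_mul, re_inner_self, re_inner_self] at h1
    have h2 := hbound x hx
    have h3 : 0 < ‖T x‖ := norm_pos_iff.2 hv0
    have h4 : ‖x‖ ^ 2 ≤ (C * ‖T x‖) ^ 2 := by gcongr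
    rw [h1, mul_pow] at h4
    have h5 : μ - κ ≤ C ^ 2 := le_of_mul_le_mul_right h4 (by positivity)
    rw [hs, inv_mul_eq_div, le_div_iff₀ (by linarith)]
    linarith
  have hSsa := isSelfAdjoint_ritzOp hT.isSelfAdjoint Y
  have hSfin := finite_spectrum_ritzOp T Y
  -- `u` is an approximate eigenvector of the Galerkin resolvent of `W`
  obtain ⟨s', hs', hss'⟩ : ∃ s' ∈ spectrum ℝ (ritzOp T Y), |s' - s| < 3 * ε := by
    by_contra! hcon
    have h1 := le_norm_sub_smul (J := Set.univ) (by positivity : (0 : ℝ) < 3 * ε)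
      (fun x hx => hcon x hx.1) hSsa (splitsSpectrum_of_finite hSfin _) u
    have h2 : specProj (ritzOp T Y) Set.univ = 1 := by
      rw [specProj, cutoff, Set.indicator_univ]
      exact cfc_one ℝ _
    have h3 : ritzOp T Y u - (s : ℂ) • u = -((ritzOp T X - ritzOp T Y) u) := by
      rw [sub_apply, hu]; abel
    rw [h2, h3, norm_neg, one_apply_eq_self] at h1
    have h4 := (ritzOp T X - ritzOp T Y).le_of_opNorm_le hclose u
    have h5 : 0 < ‖u‖ := norm_pos_iff.2 hu0
    nlinarith
  have hC2 : 0 < C ^ 2 := by positivity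
  have hs'C : 1 ≤ 2 * (s' * C ^ 2) := by
    have h1 := (abs_lt.1 hss').1
    nlinarith
  have hs'0 : 0 < s' := by
    by_contra! hle
    nlinarith
  obtain ⟨w, hw0, hw⟩ := exists_eigenvector_of_finite_spectrum hSsa hSfin hs'
  have hs'1 : s' ≤ 1 := by
    have h1 := (ritzOp T Y).le_of_opNorm_le (hT.norm_ritzOp_le Y) w
    rw [hw, norm_smul, Complex.norm_real, Real.norm_eq_abs, one_mul, abs_of_pos hs'0] at h1
    have h5 : 0 < ‖w‖ := norm_pos_iff.2 hw0
    by_contra! hlt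
    nlinarith
  refine ⟨κ + s'⁻¹, (hT.mem_galerkinSpec_iff hXW).2 ⟨?_, w, hw0, ?_⟩, ?_⟩
  · linarith [(one_le_inv₀ hs'0).2 hs'1]
  · rw [add_sub_cancel_left, inv_inv, hw]
  · have h1 : μ - (κ + s'⁻¹) = (s' - s) * (s⁻¹ * s'⁻¹) := by
      have : μ = κ + s⁻¹ := by rw [hs, inv_inv]; ring
      rw [this]
      field_simp
      ring
    have h2 : s⁻¹ ≤ C ^ 2 := by
      rw [inv_le_iff_one_le_mul₀ hs0]
      linarith
    have h3 : s'⁻¹ ≤ 2 * C ^ 2 := by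
      rw [inv_le_iff_one_le_mul₀ hs'0]
      linarith
    have h4 : 0 < s⁻¹ := inv_pos.2 hs0
    have h5 : 0 < s'⁻¹ := inv_pos.2 hs'0
    rw [h1, abs_mul, abs_of_pos (by positivity : 0 < s⁻¹ * s'⁻¹)]
    calc |s' - s| * (s⁻¹ * s'⁻¹) ≤ 3 * ε * (C ^ 2 * (2 * C ^ 2)) := by gcongr
      _ = 6 * C ^ 4 * ε := by ring

/-- The Galerkin eigenvalues for the spectral subspace itself are the eigenvalues of `A`. -/
theorem galerkinSpec_eigSpaceIcc {a b : ℝ} (hess : ∀ t ∈ Set.Icc a b, (t : ℂ) ∉ essSpec A)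
    (hκb : κ + 1 ≤ b) (hdom : eigSpaceIcc A a b ≤ formDomain A) :
    galerkinSpec A (eigSpaceIcc A a b) = {t : ℝ | t ∈ Set.Icc a b ∧ (t : ℂ) ∈ spec A} := by
  have hV := hT.eigSpaceIcc_eq hess hκb
  have := hT.finiteDimensional_eigSum hess hκb
  rw [← hV] at this
  have := hT.finiteDimensional_comap (eigSpaceIcc A a b)
  have hX := hT.map_comap hdom
  set V := eigSpaceIcc A a b
  set X := V.comap (T : H →ₗ[ℂ] H)
  have hR := hT.isSelfAdjoint_mul_self
  have hsplit := hT.splitsSpectrum_invIcc hess hκb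
  have hfin := hT.finite_spectrum_inter hess hκb
  have hfix : ∀ u ∈ V, specProj (T * T) (invIcc κ a b) u = u := fun u hu =>
    specProj_apply_of_mem hR hsplit hfin (hV ▸ hu)
  -- on the spectral subspace the Galerkin resolvent is the resolvent of `A`
  have hS : ∀ u ∈ V, ritzOp T X u = (T * T) u := by
    intro u hu
    have h1 : T u ∈ X := by
      show (T * T) u ∈ V
      have h2 := specProj_apply_sub_smul hR hsplit 0 u
      rw [Complex.ofReal_zero, zero_smul, zero_smul, sub_zero, sub_zero, hfix u hu] at h2
      rw [← h2, hV]
      exact specProj_apply_mem hR hsplit hfin _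
    rw [ritzOp_apply, Submodule.starProjection_eq_self_iff.2 h1]
    rfl
  ext t
  rw [hT.mem_galerkinSpec_iff hX, Set.mem_ofPred_eq, hT.mem_Icc_and_mem_spec_iff (by linarith)]
  constructor
  · rintro ⟨h1, u, hu0, hu⟩
    have hs0 : (((t - κ)⁻¹ : ℝ) : ℂ) ≠ 0 := by
      exact_mod_cast (inv_pos.2 (by linarith : 0 < t - κ)).ne'
    have huV : u ∈ V := by
      have h2 : ritzOp T X u ∈ V := Submodule.starProjection_apply_mem X (T u)
      have h3 := V.smul_mem (((t - κ)⁻¹ : ℝ) : ℂ)⁻¹ h2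
      rwa [hu, inv_smul_smul₀ hs0] at h3
    rw [hS u huV] at hu
    have hspec := mem_spectrum_of_apply_eq hu0 hu
    refine ⟨by linarith, hspec, ?_⟩
    by_contra hnot
    -- an eigenvector with eigenvalue outside of the interval is killed by the projection
    have hc : ∀ s ∈ spectrum ℝ (T * T) ∩ invIcc κ a b, s ≠ (t - κ)⁻¹ := fun s hs h =>
      hnot (h ▸ hs.2)
    have h3 : cutoff (T * T) (invIcc κ a b) (fun s => (s - (t - κ)⁻¹)⁻¹) *
        (T * T - (((t - κ)⁻¹ : ℝ) : ℂ) • 1) = specProj (T * T) (invIcc κ a b) := by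
      rw [cutoff_mul_sub_smul hR hsplit, specProj]
      · exact cutoff_congr fun s hs => mul_inv_cancel₀ (sub_ne_zero.2 (hc s hs))
      · exact ContinuousOn.inv₀ (by fun_prop) fun s hs => sub_ne_zero.2 (hc s hs)
    have h4 := congrArg (fun D : H →L[ℂ] H => D u) h3
    rw [show ((cutoff (T * T) (invIcc κ a b) (fun s => (s - (t - κ)⁻¹)⁻¹) *
        (T * T - (((t - κ)⁻¹ : ℝ) : ℂ) • 1)) u) = cutoff (T * T) (invIcc κ a b)
        (fun s => (s - (t - κ)⁻¹)⁻¹) ((T * T) u - (((t - κ)⁻¹ : ℝ) : ℂ) • u) from rfl, hu,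
      sub_self, map_zero, hfix u huV] at h4
    exact hu0 h4.symm
  · rintro ⟨h1, h2⟩
    have h3 := (hT.mem_Icc_and_mem_spec_iff (by linarith : κ < b)).2 ⟨h1, h2⟩
    refine ⟨not_lt.1 fun h => hT.notMem_spec t h h3.2, ?_⟩
    have hd := hT.add_inv_mem_discSpec hess hκb h2
    rw [inv_inv, add_sub_cancel] at hd
    obtain ⟨u, hu, hu0⟩ := Submodule.exists_mem_ne_zero_of_ne_bot hd.2.2.1
    rw [hT.eigSpace_eq h1.ne', mem_eigenspace_iff] at hu
    refine ⟨u, hu0, ?_⟩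
    rw [hS u (hV ▸ mem_eigSum h2.2 hu), hu]

end FormRoot

end Hilbert

end SpectralApprox

end

/-! ### Convergence of the filtered Galerkin spaces -/

theorem mainTheorem1 {H : Type*} [NormedAddCommGroup H] [InnerProductSpace ℂ H] [CompleteSpace H]
    (hdim : ¬ FiniteDimensional ℂ H)
    -- a self-adjoint operator, bounded from below
    (A : H →ₗ.[ℂ] H) (hA : IsSelfAdjoint A) (hsemi : SemiboundedBelow A)
    -- the interval `Δ = [a, b]`
    (a b : ℝ) (hab : a < b)
    (ha : (a : ℂ) ∈ opResolventSet A) (hb : (b : ℂ) ∈ opResolventSet A)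
    (hess : ∀ t ∈ Set.Icc a b, (t : ℂ) ∉ essSpec A)
    (hne : ∃ t ∈ Set.Icc a b, (t : ℂ) ∈ spec A)
    -- the trial spaces
    (Ln : ℕ → Submodule ℂ H) [∀ n, FiniteDimensional ℂ (Ln n)]
    (hform : ∀ n, Ln n ≤ formDomain A)
    (hdense : ∀ u : formDomain A, ∃ un : ℕ → formDomain A, (∀ n, (un n : H) ∈ Ln n) ∧
      Tendsto (fun n => formNorm A (u - un n)) atTop (𝓝 0))
    -- the auxiliary finite-dimensional space
    (L : Submodule ℂ H) [FiniteDimensional ℂ L]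
    (hgap : gap (fun u : H => ‖u‖) (eigSpaceIcc A a b) L < 1) :
    ∃ γ : ℝ, IsLeast {t : ℝ | (t : ℂ) ∈ discSpec (ofBounded (auxOp A a b L))} γ ∧ 0 < γ ∧
      ∀ M : ℕ → Submodule ℂ H,
        (∀ n, M n = filteredSpace (galerkinSpace A (Ln n) a b) L (γ / 2) 1) →
        Tendsto (fun n => symGap (fun u : H => ‖u‖) (M n) (eigSpaceIcc A a b)) atTop (𝓝 0) ∧
        Tendsto (fun n => symGapForm A (M n) (eigSpaceIcc A a b)) atTop (𝓝 0) ∧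
        Tendsto (fun n => Metric.hausdorffEDist (galerkinSpec A (M n))
          {t : ℝ | t ∈ Set.Icc a b ∧ (t : ℂ) ∈ spec A}) atTop (𝓝 0) := by
  obtain ⟨T, hT⟩ := exists_formRoot hA hsemi ha
  set κ := specMin A - 1
  have hκb : κ + 1 ≤ b := by
    obtain ⟨t, ht, hts⟩ := hne
    exact (not_lt.1 fun h => hT.notMem_spec t h hts).trans ht.2
  have hκb' : κ < b := by linarith
  have hV := hT.eigSpaceIcc_eq hess hκb
  have hVfin : FiniteDimensional ℂ (eigSpaceIcc A a b) :=
    hV ▸ hT.finiteDimensional_eigSum hess hκb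
  have hinj : ∀ u ∈ eigSpaceIcc A a b, L.starProjection u = 0 → u = 0 := fun u hu =>
    eq_zero_of_gap_lt_one hgap hu
  obtain ⟨γ, hleast, hγ, hmin⟩ :=
    exists_isLeast_discSpec hdim (eigSpaceIcc A a b) L (eigSpaceIcc_ne_bot hess hne) hinj
  refine ⟨γ, hleast, hγ, fun M hM => ?_⟩
  have hXfin : ∀ n, FiniteDimensional ℂ ((Ln n).comap (T : H →ₗ[ℂ] H)) := fun n =>
    hT.finiteDimensional_comap (Ln n)
  have hX : ∀ x, Tendsto (fun n => ((Ln n).comap (T : H →ₗ[ℂ] H)).starProjection x) atTop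
      (𝓝 x) := by
    intro x
    refine tendsto_starProjection_of_exists_tendsto ?_
    obtain ⟨un, hun, hlim⟩ := hdense ⟨T x, hT.apply_mem x⟩
    choose y hy using fun n => (hT.mem_formDomain (un n)).1 (un n).2
    refine ⟨y, fun n => ?_, hlim.congr fun n => ?_⟩
    · show T (y n) ∈ Ln n
      rw [hy]
      exact hun n
    · rw [show (⟨T x, hT.apply_mem x⟩ : formDomain A) - un n = ⟨T (x - y n), hT.apply_mem _⟩ from
        Subtype.ext (by simp [hy]), hT.formNorm_apply]
  have hα : 0 < (b - κ)⁻¹ := inv_pos.2 (by linarith)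
  have hsplit := hT.splitsSpectrum_invIcc hess hκb
  have hfin := hT.finite_spectrum_inter hess hκb
  have hW := fun n => hT.galerkinSpace_eq (hT.map_comap (hform n)) (a := a) hκb'
  have hM' : ∀ n, M n =
      eigSum (compressionOp (galerkinSpace A (Ln n) a b) L) (Set.Icc (γ / 2) 1) := fun n =>
    (hM n).trans (filteredSpace_eq _ L (half_pos hγ))
  have hclose : ∀ ε > 0, ∀ᶠ n in atTop,
      RelClose T ((M n).comap (T : H →ₗ[ℂ] H)) ((eigSpaceIcc A a b).comap (T : H →ₗ[ℂ] H)) ε ∧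
      RelClose T ((eigSpaceIcc A a b).comap (T : H →ₗ[ℂ] H))
        ((M n).comap (T : H →ₗ[ℂ] H)) ε := fun ε hε => by
    have h := eventually_relClose hT.isSelfAdjoint hX hα
      (fun s hs => hT.mem_Ioo_of_mem hκb ha hb hs) hsplit hfin hT.norm_le_one hT.injective hV hW L
      hinj hγ hmin hε
    simpa only [← hM'] using h
  have hMW : ∀ n, M n ≤ galerkinSpace A (Ln n) a b := fun n => by
    rw [hM n]
    exact Submodule.map_subtype_le _ _
  have hMdom : ∀ n, M n ≤ formDomain A := fun n =>
    (hMW n).trans ((galerkinSpace_le A (Ln n) a b).trans (hform n))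
  have hMfin : ∀ n, FiniteDimensional ℂ (M n) := fun n =>
    Submodule.finiteDimensional_of_le (hMW n)
  have hR := hT.isSelfAdjoint_mul_self
  -- the form norm is bounded by `(b - κ) ‖·‖` on all spaces involved
  have hVbound : ∀ x, T x ∈ eigSpaceIcc A a b → ‖x‖ ≤ ((b - κ)⁻¹)⁻¹ * ‖T x‖ := fun x hx =>
    (norm_le_of_apply_mem_eigSum (P := 1) hT.norm_le_one hT.injective
      ContinuousLinearMap.norm_id_le (by rw [mul_one]) hR hα (fun s hs => hs.1) hsplit hfin
      (hV ▸ hx)).2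
  have hMbound : ∀ n x, T x ∈ M n → ‖x‖ ≤ ((b - κ)⁻¹)⁻¹ * ‖T x‖ := fun n x hx =>
    (norm_le_of_apply_mem_eigSum hT.norm_le_one hT.injective
      (Submodule.starProjection_norm_le _) rfl (isSelfAdjoint_ritzOp hT.isSelfAdjoint _) hα
      (fun s hs => hs.1) (splitsSpectrum_of_finite (finite_spectrum_ritzOp T _) _)
      ((finite_spectrum_ritzOp T _).inter_of_left _) (hW n ▸ hMW n hx)).2
  have hVdom : eigSpaceIcc A a b ≤ formDomain A := fun u hu => by
    have h1 := specProj_apply_of_mem hR hsplit hfin (hV ▸ hu)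
    rw [← mul_specLift (T := T) (P := 1) (by rw [mul_one]) hR hα (fun s hs => hs.1) hsplit] at h1
    exact (hT.mem_formDomain u).2 ⟨_, h1⟩
  refine ⟨?_, ?_, ?_⟩
  · rw [Metric.tendsto_nhds]
    intro ε hε
    filter_upwards [hclose (ε / 2) (half_pos hε)] with n hn
    have h1 := (hT.symGap_le_of_relClose (hMdom n) hVdom (half_pos hε).le hn.1 hn.2).1
    rw [Real.dist_0_eq_abs, abs_of_nonneg (symGap_nonneg (fun _ => norm_nonneg _) _ _)]
    linarith
  · rw [Metric.tendsto_nhds]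
    intro ε hε
    filter_upwards [hclose (ε / 2) (half_pos hε)] with n hn
    have h1 := (hT.symGap_le_of_relClose (hMdom n) hVdom (half_pos hε).le hn.1 hn.2).2
    have h2 : 0 ≤ symGapForm A (M n) (eigSpaceIcc A a b) :=
      symGap_nonneg (formNorm_nonneg A) _ _
    rw [Real.dist_0_eq_abs, abs_of_nonneg h2]
    linarith
  · rw [← hT.galerkinSpec_eigSpaceIcc hess hκb hVdom, ENNReal.tendsto_nhds_zero]
    intro δ hδ
    set C := ((b - κ)⁻¹)⁻¹
    have hC : 0 < C := inv_pos.2 hα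
    -- `ε` is small enough for `6 ε C² ≤ 1` and `6 C⁴ ε ≤ δ`
    obtain ⟨ε, hε, hεC, hεδ⟩ : ∃ ε > 0, 6 * ε * C ^ 2 ≤ 1 ∧ ENNReal.ofReal (6 * C ^ 4 * ε) ≤ δ := by
      have h1 : Tendsto (fun ε : ℝ => 6 * ε * C ^ 2) (𝓝[>] 0) (𝓝 0) := by
        have : Continuous fun ε : ℝ => 6 * ε * C ^ 2 := by fun_prop
        simpa using (this.tendsto 0).mono_left nhdsWithin_le_nhds
      have h2 : Tendsto (fun ε : ℝ => ENNReal.ofReal (6 * C ^ 4 * ε)) (𝓝[>] 0) (𝓝 0) := by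
        have : Continuous fun ε : ℝ => ENNReal.ofReal (6 * C ^ 4 * ε) :=
          ENNReal.continuous_ofReal.comp (by fun_prop)
        simpa using (this.tendsto 0).mono_left nhdsWithin_le_nhds
      obtain ⟨ε, h3, h4, h5⟩ := ((eventually_mem_nhdsWithin (s := Set.Ioi (0 : ℝ))).and
        ((h1.eventually_le_const one_pos).and (h2.eventually_le_const hδ))).exists
      exact ⟨ε, h3, h4, h5⟩
    filter_upwards [hclose ε hε] with n hn
    refine (Metric.hausdorffEDist_le_of_mem_edist (r := ENNReal.ofReal (6 * C ^ 4 * ε))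
      (fun μ hμ => ?_) (fun μ hμ => ?_)).trans hεδ
    · obtain ⟨ν, hν, hle⟩ := hT.exists_mem_galerkinSpec (hMdom n) hVdom hC (hMbound n) hε hεC
        hn.1 hn.2 hμ
      refine ⟨ν, hν, ?_⟩
      rw [edist_dist, Real.dist_eq]
      exact ENNReal.ofReal_le_ofReal hle
    · obtain ⟨ν, hν, hle⟩ := hT.exists_mem_galerkinSpec hVdom (hMdom n) hC hVbound hε hεC
        hn.2 hn.1 hμ
      refine ⟨ν, hν, ?_⟩
      rw [edist_dist, Real.dist_eq]
      exact ENNReal.ofReal_le_ofReal hle
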